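/- Let $X$ be a measurable space, $T:X\to X$ a measurable map, $Y\subset X$, and let $F=T^{\varphi}:Y\to Y$, $F(y)=T^{\varphi(y)}(y)$, be an induced map with measurable return time $\varphi:Y\to\{1,2,\dots\}$ (not necessarily the first return time). Let $\mu$ be an ergodic $F$-invariant probability measure on $Y$ with $\varphi\in L^1(Y,\mu)$. Let $\Delta=\{(y,\ell)\in Y\times\mathbb Z:0\le\ell\le\varphi(y)-1\}$, $\mu_\Delta=(\mu\times\text{counting})|_\Delta/\int_Y\varphi\,d\mu$, $\pi(y,\ell)=T^\ell y$, and $\mu_X=\pi_*\mu_\Delta$. For $v,w\in L^\infty(X,\mu_X)$ put $$\rho_{v,w}(n)=\int_X v\;w\circ T^n\,d\mu_X-\int_X v\,d\mu_X\int_X w\,d\mu_X .$$ Let $R:L^1(Y)\to L^1(Y)$ be the transfer operator of $F$, i.e. $\int_Y (Rg)\,w\,d\mu=\int_Y g\;w\circ F\,d\mu$ for $g\in L^1(Y)$, $w\in L^\infty(Y)$, and let $R_n g=R(1_{\{\varphi=n\}}g)$, $n\ge1$. Let $\mathcal B(Y)\subset L^1(Y;\mathbb C)$ be a complex Banach space with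 norm $\|\cdot\|$ that contains the constant functions and satisfies $|g|_1\le\|g\|$ for all $g\in\mathcal B(Y)$. Suppose that the inducing scheme is good with respect to $\mathcal B(Y)$, that is: * each $R_n$ restricts to a bounded operator on $\mathcal B(Y)$, and $\sum_{n\ge1}\sum_{j>n}\|R_j\|<\infty$; * writing $R(z)=\sum_{n\ge1}R_nz^n$ (bounded operators on $\mathcal B(Y)$, $|z|\le1$), the number $1$ is an (algebraically) simple eigenvalue of $R(1)$, isolated in the spectrum of $R(1)$; * for $|z|\le1$, $z\ne1$, the spectrum of $R(z)$ does not contain $1$. A function $\hat v:Y\to\mathbb R$ is derived from $v:X\to\mathbb R$ if for every $n\ge1$ there is $j\in\{0,\dots,n-1\}$ such that $\hat v(y)=v(T^jy)$ for all $y\in Y$ with $\varphi(y)=n$; and $v$ is exchangeable if the set of all functions derived from $v$ is a bounded subset of $\mathcal B(Y)$. Suppose further that $\sum_{n\ge1}n^{\epsilon}\sum_{j>n}\|R_j\|<\infty$ for some $\epsilon>0$. Let $q>0$ and suppose that $\varphi\in L^{q+1}(Y,\mu)$. Then $$\sum_{n=1}^\infty n^{q-1}\,|\rho_{v,w}(n)|<\infty$$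 for every exchangeable $v\in L^\infty(X,\mu_X)$ and every $w\in L^\infty(X,\mu_X)$. -/

import Mathlib

open MeasureTheory Set Filter
open scoped ENNReal

noncomputable section

namespace InducedDecay

/-! ### The transfer operator -/

section Transfer

variable {Y : Type*} [MeasurableSpace Y]

/-- Radon-Nikodym derivative with respect to `μ` of the push-forward under `F` of the signed
measure `g dμ`, for a real function `g ∈ L¹(μ)`. -/
def realTransfer (F : Y → Y) (μ : Measure Y) (g : Y → ℝ) : Y → ℝ :=
  SignedMeasure.rnDeriv ((μ.withDensityᵥ g).map F) μ

/-- The transfer operator `R` of the measure preserving map `F` of `(Y, μ)`, applied to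
`g ∈ L¹(Y, μ; ℂ)`: the density with respect to `μ` of the push-forward under `F` of `g dμ`.
See `integral_smul_transfer` for the dual characterization `∫ w · R g dμ = ∫ (w ∘ F) · g dμ`. -/
def transfer (F : Y → Y) (μ : Measure Y) (g : Y → ℂ) : Y → ℂ := fun y =>
  ⟨realTransfer F μ (fun x => (g x).re) y, realTransfer F μ (fun x => (g x).im) y⟩

theorem integrable_realTransfer (F : Y → Y) (μ : Measure Y) (g : Y → ℝ) :
    Integrable (realTransfer F μ g) μ :=
  SignedMeasure.integrable_rnDeriv _ _

theorem integrable_transfer (F : Y → Y) (μ : Measure Y) (g : Y → ℂ) :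
    Integrable (transfer F μ g) μ := by
  rw [← memLp_one_iff_integrable, ← memLp_re_im_iff]
  exact ⟨memLp_one_iff_integrable.2 (integrable_realTransfer _ _ _),
    memLp_one_iff_integrable.2 (integrable_realTransfer _ _ _)⟩

theorem setIntegral_realTransfer {F : Y → Y} {μ : Measure Y} [IsFiniteMeasure μ]
    (hF : MeasurePreserving F μ μ) {g : Y → ℝ} (hg : Integrable g μ)
    {A : Set Y} (hA : MeasurableSet A) :
    ∫ y in A, realTransfer F μ g y ∂μ = ∫ y in F ⁻¹' A, g y ∂μ := by
  have hac : VectorMeasure.AbsolutelyContinuous ((μ.withDensityᵥ g).map F)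
      μ.toENNRealVectorMeasure := by
    refine VectorMeasure.AbsolutelyContinuous.mk fun s hs h0 => ?_
    rw [Measure.toENNRealVectorMeasure_apply_measurable hs] at h0
    rw [VectorMeasure.map_apply _ hF.measurable hs, withDensityᵥ_apply hg (hF.measurable hs)]
    apply setIntegral_measure_zero
    rw [hF.measure_preimage hs.nullMeasurableSet, h0]
  have h := SignedMeasure.withDensityᵥ_rnDeriv_eq _ _ hac
  have h2 := congrArg (fun ν : SignedMeasure Y => ν A) h
  change μ.withDensityᵥ _ A = (μ.withDensityᵥ g).map F A at h2
  rw [withDensityᵥ_apply (SignedMeasure.integrable_rnDeriv _ _) hA,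
    VectorMeasure.map_apply _ hF.measurable hA,
    withDensityᵥ_apply hg (hF.measurable hA)] at h2
  exact h2

theorem setIntegral_transfer {F : Y → Y} {μ : Measure Y} [IsFiniteMeasure μ]
    (hF : MeasurePreserving F μ μ) {g : Y → ℂ} (hg : Integrable g μ)
    {A : Set Y} (hA : MeasurableSet A) :
    ∫ y in A, transfer F μ g y ∂μ = ∫ y in F ⁻¹' A, g y ∂μ := by
  apply Complex.ext
  · have h1 := integral_re (𝕜 := ℂ) (integrable_transfer F μ g).integrableOn (μ := μ.restrict A)
    have h2 := integral_re (𝕜 := ℂ) hg.integrableOn (μ := μ.restrict (F ⁻¹' A))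
    have h3 := setIntegral_realTransfer hF hg.re hA
    exact h1.symm.trans (h3.trans h2)
  · have h1 := integral_im (𝕜 := ℂ) (integrable_transfer F μ g).integrableOn (μ := μ.restrict A)
    have h2 := integral_im (𝕜 := ℂ) hg.integrableOn (μ := μ.restrict (F ⁻¹' A))
    have h3 := setIntegral_realTransfer hF hg.im hA
    exact h1.symm.trans (h3.trans h2)

/-- Duality between the transfer operator and the Koopman operator `w ↦ w ∘ F`. -/
theorem integral_smul_transfer {F : Y → Y} {μ : Measure Y} [IsFiniteMeasure μ]
    (hF : MeasurePreserving F μ μ) {g : Y → ℂ} (hg : Integrable g μ)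
    {w : Y → ℝ} (hw : Measurable w) {C : ℝ} (hC : ∀ y, |w y| ≤ C) :
    ∫ y, w y • transfer F μ g y ∂μ = ∫ y, w (F y) • g y ∂μ := by
  have hm : MeasurableSpace.comap F ‹_› ≤ ‹MeasurableSpace Y› := hF.measurable.comap_le
  have hti := integrable_transfer F μ g
  have htF : Integrable (fun y => transfer F μ g (F y)) μ := hF.integrable_comp_of_integrable hti
  obtain ⟨k, hk, hkt⟩ := hti.aestronglyMeasurable
  have hce : (fun y => transfer F μ g (F y)) =ᵐ[μ] μ[g | MeasurableSpace.comap F ‹_›] := by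
    refine ae_eq_condExp_of_forall_setIntegral_eq hm hg (fun s _ _ => htF.integrableOn) ?_ ?_
    · rintro s ⟨A, hA, rfl⟩ -
      rw [← setIntegral_transfer hF hg hA]
      have h := setIntegral_map (μ := μ) (f := transfer F μ g) hA
        (by rw [hF.map_eq]; exact hti.aestronglyMeasurable) hF.measurable.aemeasurable
      rw [hF.map_eq] at h
      exact h.symm
    · exact ⟨k ∘ F, hk.comp_measurable (comap_measurable F), hF.quasiMeasurePreserving.ae_eq_comp hkt⟩
  have hwF : StronglyMeasurable[MeasurableSpace.comap F ‹_›] (fun y => w (F y)) :=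
    hw.stronglyMeasurable.comp_measurable (comap_measurable F)
  have hint : Integrable (fun y => w (F y) • g y) μ :=
    hg.bdd_smul C (hw.comp hF.measurable).aestronglyMeasurable
      (ae_of_all _ fun y => hC (F y))
  have hpull := condExp_smul_of_aestronglyMeasurable_left (m := MeasurableSpace.comap F ‹_›)
    hwF.aestronglyMeasurable hint hg
  have e1 := integral_condExp (μ := μ) hm (f := fun y => w (F y) • g y)
  rw [← e1]
  have e2 : ∫ y, w y • transfer F μ g y ∂μ = ∫ y, w (F y) • transfer F μ g (F y) ∂μ := by
    have h := integral_map (μ := μ) (f := fun y => w y • transfer F μ g y)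
      hF.measurable.aemeasurable
      (by rw [hF.map_eq]; exact hw.aestronglyMeasurable.smul hti.aestronglyMeasurable)
    rw [hF.map_eq] at h
    exact h
  rw [e2]
  refine integral_congr_ae ?_
  filter_upwards [hpull, hce] with y h1 h2
  have : (μ[fun y => w (F y) • g y | MeasurableSpace.comap F ‹_›]) y
      = w (F y) • (μ[g | MeasurableSpace.comap F ‹_›]) y := h1
  rw [this, ← h2]

end Transfer

/-! ### Inducing schemes and the induced measure on `X` -/

section Scheme

variable {X : Type*} [MeasurableSpace X]

/-- `F = T^φ : Y → Y` is an induced map of `T : X → X` on `Y ⊆ X` with return time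
`φ : Y → {1, 2, …}` (not necessarily the first return time), `μ` is an ergodic `F`-invariant
probability measure on `Y`, and `φ ∈ L¹(Y, μ)`. -/
structure IsInducingScheme (T : X → X) (Y : Set X) (φ : Y → ℕ) (F : Y → Y)
    (μ : Measure Y) : Prop where
  measurable_map : Measurable T
  measurable_return : Measurable φ
  return_pos : ∀ y, 1 ≤ φ y
  induced_eq : ∀ y, (F y : X) = T^[φ y] (y : X)
  prob : IsProbabilityMeasure μ
  ergodic : Ergodic F μ
  integrable_return : Integrable (fun y => (φ y : ℝ)) μ

/-- The tower `Δ = {(y, ℓ) : 0 ≤ ℓ ≤ φ(y) - 1}`. -/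
def tower {Y : Set X} (φ : Y → ℕ) : Set (Y × ℕ) := {p | p.2 < φ p.1}

/-- The tower measure `μ_Δ = (μ × counting) / ∫ φ dμ`, concentrated on the tower. -/
def towerMeasure {Y : Set X} (φ : Y → ℕ) (μ : Measure Y) : Measure (Y × ℕ) :=
  (∫⁻ y, (φ y : ℝ≥0∞) ∂μ)⁻¹ • (μ.prod Measure.count).restrict (tower φ)

/-- The projection `π(y, ℓ) = T^ℓ y` from the tower to `X`. -/
def towerProj (T : X → X) {Y : Set X} (p : Y × ℕ) : X := T^[p.2] (p.1 : X)

/-- The measure `μ_X = π_* μ_Δ` on `X`. -/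
def inducedMeasure (T : X → X) {Y : Set X} (φ : Y → ℕ) (μ : Measure Y) : Measure X :=
  (towerMeasure φ μ).map (towerProj T)

/-- The correlation function `ρ_{v,w}(n) = ∫ v · w ∘ Tⁿ dν - ∫ v dν ∫ w dν`. -/
def correlation (T : X → X) (ν : Measure X) (v w : X → ℝ) (n : ℕ) : ℝ :=
  (∫ x, v x * w (T^[n] x) ∂ν) - (∫ x, v x ∂ν) * ∫ x, w x ∂ν

/-- The set `D_v` of observables `u : Y → ℝ` derived from `v : X → ℝ`: on each level set
`{φ = n}`, `n ≥ 1`, the function `u` coincides with `v ∘ T^j` for some `0 ≤ j ≤ n - 1`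
depending only on `n`. -/
def derived (T : X → X) {Y : Set X} (φ : Y → ℕ) (v : X → ℝ) : Set (Y → ℝ) :=
  {u | ∀ n : ℕ, 1 ≤ n → ∃ j : ℕ, j < n ∧ ∀ y : Y, φ y = n → u y = v (T^[j] (y : X))}

end Scheme

/-! ### The Banach space `B(Y)`, its renewal operators, and the spectral hypotheses -/

section Banach

variable {Y : Type*} [MeasurableSpace Y]
variable {B : Type*} [NormedAddCommGroup B] [NormedSpace ℂ B]

/-- `ι` realizes the (complex) Banach space `B` as a linear subspace `B(Y)` of `L¹(Y, μ; ℂ)` with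
`|v|₁ ≤ ‖v‖` and containing the constant functions. -/
structure IsFunctionSpace (μ : Measure Y) (ι : B →ₗ[ℂ] Lp ℂ 1 μ) : Prop where
  complete : CompleteSpace B
  injective : Function.Injective ι
  norm_le : ∀ b, ‖ι b‖ ≤ ‖b‖
  const_mem : ∀ c : ℂ, ∃ b, (ι b : Y → ℂ) =ᵐ[μ] fun _ => c

/-- For every `n`, the operator `R_n = R 1_{φ = n}` on `L¹(Y)` maps `B(Y)` into itself and its
restriction to `B(Y)` is the bounded operator `Rop n`. (In particular `Rop 0 = 0` when `φ ≥ 1`;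
and `Rop` is uniquely determined, because `ι` is injective.) -/
def IsRenewalOperators (F : Y → Y) (φ : Y → ℕ) (μ : Measure Y) (ι : B →ₗ[ℂ] Lp ℂ 1 μ)
    (Rop : ℕ → B →L[ℂ] B) : Prop :=
  ∀ (n : ℕ) (b : B), (ι (Rop n b) : Y → ℂ) =ᵐ[μ] transfer F μ ({y | φ y = n}.indicator (ι b))

/-- `∑_{j > n} ‖R_j‖`, as an element of `[0, ∞]`. -/
def normTail (Rop : ℕ → B →L[ℂ] B) (n : ℕ) : ℝ≥0∞ :=
  ∑' i : ℕ, ENNReal.ofReal ‖Rop (n + 1 + i)‖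

/-- `R(z) = ∑_{n ≥ 1} R_n zⁿ`, a series of bounded operators on `B` in the operator norm. -/
def renewalSeries (Rop : ℕ → B →L[ℂ] B) (z : ℂ) : B →L[ℂ] B :=
  ∑' n : ℕ, z ^ (n + 1) • Rop (n + 1)

/-- `1` is a simple eigenvalue of `A` (the eigenspace is one-dimensional and is complemented by the
range of `1 - A`, i.e. the algebraic multiplicity is one), isolated in the spectrum of `A`. -/
def IsSimpleIsolatedEigenvalueOne (A : B →L[ℂ] B) : Prop :=
  Module.finrank ℂ (LinearMap.ker (1 - A : B →L[ℂ] B).toLinearMap) = 1 ∧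
  IsCompl (LinearMap.ker (1 - A : B →L[ℂ] B).toLinearMap)
    (LinearMap.range (1 - A : B →L[ℂ] B).toLinearMap) ∧
  ∃ δ : ℝ, 0 < δ ∧ ∀ z : ℂ, z ∈ spectrum ℂ A → ‖z - 1‖ < δ → z = 1

/-- The inducing scheme is good with respect to `B(Y)`:
`∑_{n ≥ 1} ∑_{j > n} ‖R_j‖ < ∞`; the eigenvalue `1` of `R(1)` is simple and isolated in the
spectrum; and `1` is not in the spectrum of `R(z)` for `|z| ≤ 1`, `z ≠ 1`. -/
structure IsGood (F : Y → Y) (φ : Y → ℕ) (μ : Measure Y) (ι : B →ₗ[ℂ] Lp ℂ 1 μ)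
    (Rop : ℕ → B →L[ℂ] B) : Prop where
  space : IsFunctionSpace μ ι
  renewal : IsRenewalOperators F φ μ ι Rop
  summable : ∑' n : ℕ, normTail Rop (n + 1) < ∞
  simple_isolated : IsSimpleIsolatedEigenvalueOne (renewalSeries Rop 1)
  aperiodic : ∀ z : ℂ, ‖z‖ ≤ 1 → z ≠ 1 → (1 : ℂ) ∉ spectrum ℂ (renewalSeries Rop z)

end Banach

/-- `v : X → ℝ` is exchangeable: the set `D_v` of observables derived from `v` is a bounded subset
of `B(Y)`. -/
def Exchangeable {X : Type*} [MeasurableSpace X] (T : X → X) {Y : Set X} (φ : Y → ℕ)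
    {μ : Measure Y} {B : Type*} [NormedAddCommGroup B] [NormedSpace ℂ B]
    (ι : B →ₗ[ℂ] Lp ℂ 1 μ) (v : X → ℝ) : Prop :=
  ∃ C : ℝ, ∀ u ∈ derived T φ v, ∃ b : B, (ι b : Y → ℂ) =ᵐ[μ] (fun y => (u y : ℂ)) ∧ ‖b‖ ≤ C

end InducedDecay

end

noncomputable section

namespace InducedDecay

section WeightedSums

variable {B : Type*} [NormedAddCommGroup B] [NormedSpace ℂ B]

/-- The weighted sum `∑ c_j R_j` of a sequence of operators. -/
def wsum (R : ℕ → B →L[ℂ] B) (c : ℕ → ℂ) : B →L[ℂ] B := ∑' j, c j • R j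

/-- The geometric sum `1 + z + ⋯ + z ^ (n - 1)`. -/
def geo (z : ℂ) (n : ℕ) : ℂ := ∑ i ∈ Finset.range n, z ^ i

theorem one_sub_mul_geo (z : ℂ) (n : ℕ) : (1 - z) * geo z n = 1 - z ^ n := by
  rw [geo, mul_comm]; exact geom_sum_mul_neg z n

/-- The regularized operator `(1 - ∑ c_j R_j) (1 - P) + (∑ d_j R_j e) ⊗ m`, where `P = e ⊗ m`. -/
def regOp (R : ℕ → B →L[ℂ] B) (m : B →L[ℂ] ℂ) (e : B) (c d : ℕ → ℂ) : B →L[ℂ] B :=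
  (1 - wsum R c) * (1 - m.smulRight e) + m.smulRight (wsum R d e)

theorem regOp_apply (R : ℕ → B →L[ℂ] B) (m : B →L[ℂ] ℂ) (e : B) (c d : ℕ → ℂ) (b : B) :
    regOp R m e c d b = (b - m b • e) - wsum R c (b - m b • e) + m b • wsum R d e := by
  simp [regOp]

theorem summable_smul_of_le [CompleteSpace B] {R : ℕ → B →L[ℂ] B} {c : ℕ → ℂ} {G : ℕ → ℝ}
    (hG : Summable fun j => G j * ‖R j‖) (h : ∀ j, ‖c j‖ ≤ G j) :
    Summable fun j => c j • R j := by
  refine Summable.of_norm_bounded hG fun j => ?_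
  rw [norm_smul]
  exact mul_le_mul_of_nonneg_right (h j) (norm_nonneg _)

theorem norm_wsum_le {R : ℕ → B →L[ℂ] B} {c : ℕ → ℂ} {G : ℕ → ℝ}
    (hG : Summable fun j => G j * ‖R j‖) (h : ∀ j, ‖c j‖ ≤ G j) :
    ‖wsum R c‖ ≤ ∑' j, G j * ‖R j‖ := by
  refine tsum_of_norm_bounded hG.hasSum fun j => ?_
  rw [norm_smul]
  exact mul_le_mul_of_nonneg_right (h j) (norm_nonneg _)

theorem wsum_sub [CompleteSpace B] {R : ℕ → B →L[ℂ] B} {c c' : ℕ → ℂ} {G : ℕ → ℝ}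
    (hG : Summable fun j => G j * ‖R j‖) (h : ∀ j, ‖c j‖ ≤ G j) (h' : ∀ j, ‖c' j‖ ≤ G j) :
    wsum R c - wsum R c' = wsum R (fun j => c j - c' j) := by
  rw [wsum, wsum, wsum, ← (summable_smul_of_le hG h).tsum_sub (summable_smul_of_le hG h')]
  simp only [sub_smul]

theorem wsum_const_mul {R : ℕ → B →L[ℂ] B} (a : ℂ) (c : ℕ → ℂ) :
    wsum R (fun j => a * c j) = a • wsum R c := by
  rw [wsum, wsum, ← tsum_const_smul'']
  simp only [mul_smul]

theorem norm_regOp_sub_le [CompleteSpace B]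
    {R : ℕ → B →L[ℂ] B} (m : B →L[ℂ] ℂ) (e : B) {c c' d d' : ℕ → ℂ}
    {G H : ℕ → ℝ} (hH : Summable fun j => H j * ‖R j‖) (hG : Summable fun j => G j * ‖R j‖)
    (hc : ∀ j, ‖c j‖ ≤ H j) (hc' : ∀ j, ‖c' j‖ ≤ H j)
    (hd : ∀ j, ‖d j‖ ≤ H j) (hd' : ∀ j, ‖d' j‖ ≤ H j)
    (h1 : ∀ j, ‖c j - c' j‖ ≤ G j) (h2 : ∀ j, ‖d j - d' j‖ ≤ G j) :
    ‖regOp R m e c d - regOp R m e c' d'‖ ≤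
      (‖1 - m.smulRight e‖ + ‖m‖ * ‖e‖) * ∑' j, G j * ‖R j‖ := by
  have e1 : regOp R m e c d - regOp R m e c' d' =
      -(wsum R (fun j => c j - c' j) * (1 - m.smulRight e)) +
        m.smulRight (wsum R (fun j => d j - d' j) e) := by
    rw [← wsum_sub hH hc hc', ← wsum_sub hH hd hd']
    ext b
    simp [regOp, smul_sub]
    abel
  rw [e1]
  refine (norm_add_le _ _).trans ?_
  rw [norm_neg, ContinuousLinearMap.norm_smulRight_apply, add_mul]
  have b1 := norm_wsum_le hG h1
  have b2 := norm_wsum_le hG h2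
  refine add_le_add ?_ ?_
  · refine (norm_mul_le _ _).trans ?_
    rw [mul_comm]
    gcongr
  · rw [mul_assoc]
    gcongr
    refine (ContinuousLinearMap.le_opNorm _ _).trans ?_
    rw [mul_comm]
    gcongr

/-- The functional-analytic data of a good inducing scheme: `e` is the constant function `1`, `m` is
the integral, and `R_j` are the renewal operators. -/
structure SpectralData (R : ℕ → B →L[ℂ] B) (m : B →L[ℂ] ℂ) (e : B) : Prop where
  summable : Summable fun j : ℕ => (j : ℝ) * ‖R j‖
  zero : R 0 = 0
  norm_one : m e = 1
  fixed : wsum R (fun _ => 1) e = e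
  dual_fixed : ∀ b, m (wsum R (fun _ => 1) b) = m b
  simple : Module.finrank ℂ (LinearMap.ker (1 - wsum R (fun _ => 1)).toLinearMap) = 1
  compl : IsCompl (LinearMap.ker (1 - wsum R (fun _ => 1)).toLinearMap)
    (LinearMap.range (1 - wsum R (fun _ => 1)).toLinearMap)
  aperiodic : ∀ z : ℂ, ‖z‖ ≤ 1 → z ≠ 1 → IsUnit (1 - wsum R (fun j => z ^ j))
  mean_ne : m (wsum R (fun j => (j : ℂ)) e) ≠ 0

namespace SpectralData

variable {R : ℕ → B →L[ℂ] B} {m : B →L[ℂ] ℂ} {e : B}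

theorem summable_of_le (h : SpectralData R m e) {G : ℕ → ℝ} {C : ℝ}
    (h0 : ∀ j, 0 ≤ G j) (hG : ∀ j, 1 ≤ j → G j ≤ C * j) : Summable fun j => G j * ‖R j‖ := by
  refine Summable.of_nonneg_of_le (fun j => mul_nonneg (h0 j) (norm_nonneg _)) (fun j => ?_)
    (h.summable.mul_left C)
  rcases Nat.eq_zero_or_pos j with rfl | hj
  · simp [h.zero]
  · rw [← mul_assoc]
    exact mul_le_mul_of_nonneg_right (hG j hj) (norm_nonneg _)

theorem summable_add_one (h : SpectralData R m e) :
    Summable fun j : ℕ => ((j : ℝ) + 1) * ‖R j‖ :=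
  h.summable_of_le (C := 2) (fun j => by positivity) fun j hj => by
    have : (1 : ℝ) ≤ j := by exact_mod_cast hj
    linarith

theorem one_sub_smul_wsum_geo [CompleteSpace B]
    (h : SpectralData R m e) {z : ℂ} {p : ℕ → ℕ} {G : ℕ → ℝ}
    (hG : Summable fun j => G j * ‖R j‖) (hz : ∀ j, ‖z ^ p j‖ ≤ G j) (h1 : ∀ j, 1 ≤ G j) :
    (1 - z) • wsum R (fun j => geo z (p j)) e = e - wsum R (fun j => z ^ p j) e := by
  have h2 := wsum_sub (R := R) (c := fun _ => 1) (c' := fun j => z ^ p j) hG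
    (fun j => by simpa using h1 j) hz
  have h3 : wsum R (fun _ => 1) e - wsum R (fun j => z ^ p j) e
      = wsum R (fun j => 1 - z ^ p j) e := by
    rw [← h2]; rfl
  rw [h.fixed] at h3
  rw [h3]
  simp only [← one_sub_mul_geo]
  rw [wsum_const_mul]; rfl

theorem one_sub_smul_regOp [CompleteSpace B]
    (h : SpectralData R m e) {z : ℂ} {p : ℕ → ℕ} {G : ℕ → ℝ}
    (hG : Summable fun j => G j * ‖R j‖) (hz : ∀ j, ‖z ^ p j‖ ≤ G j) (h1 : ∀ j, 1 ≤ G j) (b : B) :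
    (1 - z) • regOp R m e (fun j => z ^ p j) (fun j => geo z (p j)) b =
      (1 - wsum R (fun j => z ^ p j)) ((1 - z) • (b - m b • e) + m b • e) := by
  rw [regOp_apply, smul_add, smul_comm, h.one_sub_smul_wsum_geo hG hz h1]
  simp
  module

theorem wsum_one_eq_of_ker (h : SpectralData R m e) {b : B}
    (hb : b - wsum R (fun _ => 1) b = 0) : b = m b • e := by
  have he : e ∈ LinearMap.ker (1 - wsum R (fun _ => 1)).toLinearMap := by
    simp [h.fixed]
  have hb' : b ∈ LinearMap.ker (1 - wsum R (fun _ => 1)).toLinearMap := by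
    simpa using hb
  have hne : (⟨e, he⟩ : LinearMap.ker (1 - wsum R (fun _ => 1)).toLinearMap) ≠ 0 := by
    intro h0
    have : e = 0 := congrArg Subtype.val h0
    have h1 := h.norm_one
    simp [this] at h1
  obtain ⟨c, hc⟩ := (finrank_eq_one_iff_of_nonzero' _ hne).1 h.simple ⟨b, hb'⟩
  have hc' : c • e = b := congrArg Subtype.val hc
  rw [← hc']
  simp [h.norm_one]

theorem isUnit_regOp_one [CompleteSpace B] (h : SpectralData R m e) :
    IsUnit (regOp R m e (fun _ => 1) (fun j => (j : ℂ))) := by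
  rw [ContinuousLinearMap.isUnit_iff_bijective]
  set q := wsum R (fun j => (j : ℂ)) e with hq
  have hm : ∀ b, m (regOp R m e (fun _ => 1) (fun j => (j : ℂ)) b) = m b * m q := by
    intro b
    rw [regOp_apply, map_add, map_sub, h.dual_fixed]
    simp [hq]
  constructor
  · rw [injective_iff_map_eq_zero]
    intro b hb
    have h1 : m b = 0 := by
      have := hm b
      rw [hb, map_zero] at this
      rcases mul_eq_zero.1 this.symm with h' | h'
      · exact h'
      · exact absurd h' h.mean_ne
    rw [regOp_apply, h1] at hb
    have := h.wsum_one_eq_of_ker (b := b) (by simpa using hb)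
    rw [this, h1, zero_smul]
  · intro c
    set s := m c / m q
    have hs : s * m q = m c := div_mul_cancel₀ _ h.mean_ne
    have hc : c - s • q ∈ LinearMap.range (1 - wsum R (fun _ => 1)).toLinearMap := by
      have htop : c - s • q ∈ LinearMap.ker (1 - wsum R (fun _ => 1)).toLinearMap ⊔
          LinearMap.range (1 - wsum R (fun _ => 1)).toLinearMap := by
        rw [h.compl.sup_eq_top]; trivial
      obtain ⟨x, hx, y, hy, hxy⟩ := Submodule.mem_sup.1 htop
      have hx1 := h.wsum_one_eq_of_ker (b := x) (by simpa using hx)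
      have hmy : m y = 0 := by
        obtain ⟨u, hu⟩ := hy
        rw [← hu]
        simp [h.dual_fixed]
      have hmx : m x = 0 := by
        have : m (x + y) = m (c - s • q) := by rw [hxy]
        simpa [hmy, hs] using this
      rw [hmx, zero_smul] at hx1
      rw [← hxy, hx1, zero_add]
      exact hy
    obtain ⟨u, hu⟩ := hc
    have hu' : u - wsum R (fun _ => 1) u = c - s • q := by simpa using hu
    refine ⟨(u - m u • e) + s • e, ?_⟩
    have h1 : m ((u - m u • e) + s • e) = s := by simp [h.norm_one]
    rw [regOp_apply, h1]
    simp only [add_sub_cancel_right, map_sub, map_smul, h.fixed]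
    rw [← hq, eq_comm, ← sub_eq_iff_eq_add, ← hu']
    abel

theorem isUnit_regOp [CompleteSpace B] (h : SpectralData R m e) {z : ℂ} (hz : ‖z‖ ≤ 1) :
    IsUnit (regOp R m e (fun j => z ^ j) (fun j => geo z j)) := by
  by_cases h1 : z = 1
  · subst h1
    simpa [geo] using h.isUnit_regOp_one
  have hz1 : (1 - z) ≠ 0 := sub_ne_zero.2 (Ne.symm h1)
  have hu := h.aperiodic z hz h1
  rw [ContinuousLinearMap.isUnit_iff_bijective] at hu ⊢
  have hpow : ∀ j : ℕ, ‖z ^ j‖ ≤ (j : ℝ) + 1 := fun j => by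
    rw [norm_pow]
    have := pow_le_one₀ (n := j) (norm_nonneg z) hz
    have : (0 : ℝ) ≤ j := by positivity
    linarith
  have key := fun b => h.one_sub_smul_regOp (p := fun j => j) h.summable_add_one hpow
    (fun j => by simp) b
  constructor
  · rw [injective_iff_map_eq_zero]
    intro b hb
    have h2 := key b
    rw [hb, smul_zero, eq_comm, ← map_zero (1 - wsum R (fun j => z ^ j))] at h2
    have h3 := hu.1 h2
    have h4 : m b = 0 := by
      have := congrArg m h3
      simpa [h.norm_one] using this
    simpa [h4, hz1] using h3
  · intro c
    obtain ⟨x, hx⟩ := hu.2 ((1 - z) • c)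
    refine ⟨(1 - z)⁻¹ • (x - m x • e) + m x • e, ?_⟩
    have h5 : m ((1 - z)⁻¹ • (x - m x • e) + m x • e) = m x := by simp [h.norm_one]
    have h6 := key ((1 - z)⁻¹ • (x - m x • e) + m x • e)
    rw [h5, add_sub_cancel_right, smul_smul, mul_inv_cancel₀ hz1, one_smul, sub_add_cancel, hx]
      at h6
    exact smul_right_injective B hz1 h6

end SpectralData

end WeightedSums

section Perturbation

theorem norm_inverse_le_of_norm_sub_le {A : Type*} [NormedRing A] [HasSummableGeomSeries A]
    {u x : A} {K : ℝ} (hu : IsUnit u) (hK : ‖Ring.inverse u‖ ≤ K) (hx : K * ‖u - x‖ ≤ 1 / 2) :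
    IsUnit x ∧ ‖Ring.inverse x‖ ≤ 2 * K := by
  have h1 : ‖Ring.inverse u * (u - x)‖ ≤ 1 / 2 :=
    (norm_mul_le _ _).trans ((mul_le_mul_of_nonneg_right hK (norm_nonneg _)).trans hx)
  have hxu : x = u * (1 - Ring.inverse u * (u - x)) := by
    rw [mul_sub, ← mul_assoc, Ring.mul_inverse_cancel _ hu]; noncomm_ring
  have hx' : IsUnit x := by
    rw [hxu]
    exact hu.mul (Units.oneSub _ (h1.trans_lt (by norm_num))).isUnit
  refine ⟨hx', ?_⟩
  have h2 : Ring.inverse x = Ring.inverse u + (Ring.inverse u * (u - x)) * Ring.inverse x := by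
    rw [mul_sub, Ring.inverse_mul_cancel _ hu, sub_mul, one_mul, mul_assoc,
      Ring.mul_inverse_cancel _ hx']
    noncomm_ring
  have h3 : ‖Ring.inverse x‖ ≤ K + 1 / 2 * ‖Ring.inverse x‖ := by
    conv_lhs => rw [h2]
    refine (norm_add_le _ _).trans (add_le_add hK ((norm_mul_le _ _).trans ?_))
    gcongr
  linarith

theorem exists_norm_pow_sub_le {z : ℂ} {r : ℝ} (hr : 1 ≤ r) (hz : ‖z‖ ≤ r) :
    ∃ z' : ℂ, ‖z'‖ ≤ 1 ∧ ∀ i : ℕ, ‖z ^ i - z' ^ i‖ ≤ r ^ i - 1 := by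
  rcases le_total ‖z‖ 1 with h1 | h1
  · exact ⟨z, h1, fun i => by simpa using one_le_pow₀ hr⟩
  · have h0 : (‖z‖ : ℂ) ≠ 0 := by
      exact_mod_cast (zero_lt_one.trans_le h1).ne'
    refine ⟨z / ‖z‖, ?_, fun i => ?_⟩
    · simp only [norm_div, Complex.norm_real, norm_norm]
      rw [div_self (zero_lt_one.trans_le h1).ne']
    · have : z ^ i - (z / ‖z‖) ^ i = (z / ‖z‖) ^ i * (((‖z‖ ^ i - 1 : ℝ)) : ℂ) := by
        push_cast
        rw [div_pow]
        field_simp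
      rw [this, norm_mul, norm_pow, norm_div, Complex.norm_real, Complex.norm_real, norm_norm,
        div_self (zero_lt_one.trans_le h1).ne', one_pow, one_mul, Real.norm_of_nonneg]
      · gcongr
      · simpa using one_le_pow₀ h1

theorem norm_geo_le {z : ℂ} {r : ℝ} (hr : 1 ≤ r) (hz : ‖z‖ ≤ r) {n k : ℕ} (hk : n ≤ k) :
    ‖geo z n‖ ≤ n * r ^ k := by
  rw [geo]
  refine (norm_sum_le _ _).trans ?_
  refine (Finset.sum_le_card_nsmul _ _ (r ^ k) fun i hi => ?_).trans (by simp)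
  rw [norm_pow]
  have := Finset.mem_range.1 hi
  calc ‖z‖ ^ i ≤ r ^ i := by gcongr
    _ ≤ r ^ k := pow_le_pow_right₀ hr (by omega)

theorem norm_geo_sub_le {z z' : ℂ} {r : ℝ} (hr : 1 ≤ r)
    (h : ∀ i : ℕ, ‖z ^ i - z' ^ i‖ ≤ r ^ i - 1) (n : ℕ) :
    ‖geo z n - geo z' n‖ ≤ n * (r ^ n - 1) := by
  rw [geo, geo, ← Finset.sum_sub_distrib]
  refine (norm_sum_le _ _).trans ?_
  refine (Finset.sum_le_card_nsmul _ _ (r ^ n - 1) fun i hi => (h i).trans ?_).trans (by simp)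
  have := Finset.mem_range.1 hi
  exact sub_le_sub_right (pow_le_pow_right₀ hr (by omega)) 1

/-- The radius `k ^ (ε / k)` of the disc on which the truncated resolvent is controlled. -/
def radius (ε : ℝ) (k : ℕ) : ℝ := (k : ℝ) ^ (ε / k)

theorem one_le_radius {ε : ℝ} (hε : 0 ≤ ε) {k : ℕ} (hk : 1 ≤ k) : 1 ≤ radius ε k :=
  Real.one_le_rpow (by exact_mod_cast hk) (by positivity)

theorem radius_pow {ε : ℝ} {k : ℕ} (n : ℕ) :
    radius ε k ^ n = (k : ℝ) ^ (ε / k * n) := by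
  rw [radius, Real.rpow_mul_natCast (by positivity)]

theorem radius_pow_self {ε : ℝ} {k : ℕ} (hk : 1 ≤ k) : radius ε k ^ k = (k : ℝ) ^ ε := by
  rw [radius_pow, div_mul_cancel₀]
  exact_mod_cast (by omega : k ≠ 0)

theorem radius_pow_min_le {ε : ℝ} (hε : 0 ≤ ε) {k j : ℕ} (hk : 1 ≤ k) (hj : 1 ≤ j) :
    radius ε k ^ min j k ≤ (Real.exp 1 * j) ^ ε := by
  have hk0 : (0 : ℝ) < k := by exact_mod_cast hk
  have hj0 : (0 : ℝ) < j := by exact_mod_cast hj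
  have hj1 : (1 : ℝ) ≤ j := by exact_mod_cast hj
  have he : (1 : ℝ) ≤ Real.exp 1 := Real.one_le_exp (by norm_num)
  rcases le_total j k with h | h
  · rw [min_eq_left h, radius_pow]
    have hjk : (j : ℝ) ≤ k := by exact_mod_cast h
    rw [Real.rpow_def_of_pos hk0, Real.rpow_def_of_pos (by positivity),
      Real.log_mul (Real.exp_pos 1).ne' hj0.ne', Real.log_exp]
    apply Real.exp_le_exp.2
    have h1 : Real.log (k / j) ≤ k / j - 1 := Real.log_le_sub_one_of_pos (by positivity)
    rw [Real.log_div hk0.ne' hj0.ne'] at h1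
    have h2 : (j / k : ℝ) * Real.log k ≤ (j / k) * (Real.log j + (k / j - 1)) := by
      gcongr; linarith
    have h3 : (j / k : ℝ) * (Real.log j + (k / j - 1)) = j / k * Real.log j + (1 - j / k) := by
      field_simp
    have h4 : (j / k : ℝ) * Real.log j ≤ 1 * Real.log j := by
      gcongr
      exact (div_le_one hk0).2 hjk
    have h5 : (0 : ℝ) ≤ j / k := by positivity
    have h6 : (j / k : ℝ) * Real.log k ≤ 1 + Real.log j := by linarith
    calc Real.log k * (ε / k * j) = (j / k * Real.log k) * ε := by ring
      _ ≤ (1 + Real.log j) * ε := by gcongr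
  · rw [min_eq_right h, radius_pow_self hk]
    have : (k : ℝ) ≤ j := by exact_mod_cast h
    gcongr
    nlinarith

theorem tendsto_radius (ε : ℝ) : Tendsto (radius ε) atTop (nhds 1) := by
  have h1 : Tendsto (fun x : ℝ => Real.log x / x) atTop (nhds 0) := by
    simpa using Real.tendsto_pow_log_div_mul_add_atTop 1 0 1 one_ne_zero
  have h2 : Tendsto (fun x : ℝ => Real.exp (ε * (Real.log x / x))) atTop (nhds 1) := by
    have := (Real.continuous_exp.tendsto (ε * 0)).comp (h1.const_mul ε)
    simpa [Function.comp_def] using this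
  refine (h2.comp tendsto_natCast_atTop_atTop).congr' ?_
  filter_upwards [eventually_ge_atTop 1] with k hk
  have hk0 : (0 : ℝ) < k := by exact_mod_cast hk
  rw [Function.comp, radius, Real.rpow_def_of_pos hk0]
  congr 1
  ring

end Perturbation

namespace SpectralData

variable {B : Type*} [NormedAddCommGroup B] [NormedSpace ℂ B]
  {R : ℕ → B →L[ℂ] B} {m : B →L[ℂ] ℂ} {e : B}

theorem exists_bound_inverse_regOp [CompleteSpace B] (h : SpectralData R m e) :
    ∃ K : ℝ, 0 < K ∧ ∀ z : ℂ, ‖z‖ ≤ 1 →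
      ‖Ring.inverse (regOp R m e (fun j => z ^ j) (fun j => geo z j))‖ ≤ K := by
  have hw : ∀ c : ℂ → ℕ → ℂ, (∀ j, Continuous fun z => c z j) →
      (∀ z, ‖z‖ ≤ 1 → ∀ j, ‖c z j‖ ≤ (j : ℝ) + 1) →
      ContinuousOn (fun z => wsum R (c z)) (Metric.closedBall 0 1) := by
    intro c hc hb
    refine continuousOn_tsum (fun j => ((hc j).smul continuous_const).continuousOn)
      h.summable_add_one fun j z hz => ?_
    rw [norm_smul]
    exact mul_le_mul_of_nonneg_right (hb z (by simpa using hz) j) (norm_nonneg _)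
  have h1 := hw (fun z j => z ^ j) (fun j => by fun_prop) fun z hz j => by
    rw [norm_pow]
    have := pow_le_one₀ (n := j) (norm_nonneg z) hz
    have : (0 : ℝ) ≤ j := by positivity
    linarith
  have h2 := hw (fun z j => geo z j) (fun j => by unfold geo; fun_prop) fun z hz j => by
    have := norm_geo_le (z := z) le_rfl hz (le_refl j)
    simp only [one_pow, mul_one] at this
    linarith
  have hc : ContinuousOn (fun z : ℂ => regOp R m e (fun j => z ^ j) (fun j => geo z j))
      (Metric.closedBall 0 1) := by
    unfold regOp
    refine ((continuousOn_const.sub h1).mul continuousOn_const).add ?_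
    have h3 : Continuous fun f : B => (m.smulRight f : B →L[ℂ] B) :=
      (ContinuousLinearMap.smulRightL ℂ B B m).continuous
    exact h3.comp_continuousOn (h2.clm_apply continuousOn_const)
  have hi : ContinuousOn (fun z : ℂ => Ring.inverse
      (regOp R m e (fun j => z ^ j) (fun j => geo z j))) (Metric.closedBall 0 1) := by
    intro z hz
    have hu := h.isUnit_regOp (z := z) (by simpa using hz)
    have h4 := NormedRing.inverse_continuousAt hu.unit
    exact ContinuousAt.comp_continuousWithinAt (by simpa using h4) (hc z hz)
  obtain ⟨K, hK⟩ := (isCompact_closedBall (0 : ℂ) 1).exists_bound_of_continuousOn hi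
  refine ⟨max K 1, by positivity, fun z hz => (hK z (by simpa using hz)).trans (le_max_left _ _)⟩

/-- Bound for the distance between the weights of the truncated and of the full operator. -/
def truncErr (r : ℝ) (k j : ℕ) : ℝ := j * ((r ^ min j k - 1) + if k < j then 2 else 0)

theorem truncErr_nonneg {r : ℝ} (hr : 1 ≤ r) (k j : ℕ) : 0 ≤ truncErr r k j := by
  unfold truncErr
  have := one_le_pow₀ (n := min j k) hr
  refine mul_nonneg (by positivity) (add_nonneg (by linarith) ?_)
  split_ifs <;> norm_num

theorem norm_pow_min_sub_le {z z' : ℂ} {r : ℝ} (hz' : ‖z'‖ ≤ 1)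
    (h : ∀ i : ℕ, ‖z ^ i - z' ^ i‖ ≤ r ^ i - 1) (k j : ℕ) :
    ‖z ^ min j k - z' ^ j‖ ≤ truncErr r k j := by
  rcases Nat.eq_zero_or_pos j with rfl | hj
  · simp [truncErr]
  have hj1 : (1 : ℝ) ≤ j := by exact_mod_cast hj
  have h1 : ‖z ^ min j k - z' ^ j‖ ≤ (r ^ min j k - 1) + if k < j then 2 else 0 := by
    split_ifs with hk
    · have e1 : z ^ min j k - z' ^ j = (z ^ min j k - z' ^ min j k) + (z' ^ min j k - z' ^ j) := by
        ring
      rw [e1]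
      refine (norm_add_le _ _).trans (add_le_add (h _) ((norm_sub_le _ _).trans ?_))
      rw [norm_pow, norm_pow]
      have a1 := pow_le_one₀ (n := j) (norm_nonneg z') hz'
      have a2 := pow_le_one₀ (n := min j k) (norm_nonneg z') hz'
      linarith
    · rw [min_eq_left (by omega), add_zero]
      exact h j
  refine h1.trans ?_
  unfold truncErr
  exact le_mul_of_one_le_left ((norm_nonneg _).trans h1) hj1

theorem norm_geo_min_sub_le {z z' : ℂ} {r : ℝ} (hr : 1 ≤ r) (hz' : ‖z'‖ ≤ 1)
    (h : ∀ i : ℕ, ‖z ^ i - z' ^ i‖ ≤ r ^ i - 1) (k j : ℕ) :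
    ‖geo z (min j k) - geo z' j‖ ≤ truncErr r k j := by
  have h0 : (0 : ℝ) ≤ r ^ min j k - 1 := by
    have := one_le_pow₀ (n := min j k) hr
    linarith
  have h1 : ‖geo z (min j k) - geo z' (min j k)‖ ≤ j * (r ^ min j k - 1) := by
    refine (norm_geo_sub_le hr h _).trans ?_
    gcongr
    exact min_le_left _ _
  unfold truncErr
  rw [mul_add]
  split_ifs with hk
  · have e1 : geo z (min j k) - geo z' j
        = (geo z (min j k) - geo z' (min j k)) + (geo z' (min j k) - geo z' j) := by ring
    rw [e1]
    refine (norm_add_le _ _).trans (add_le_add h1 ((norm_sub_le _ _).trans ?_))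
    have a1 := norm_geo_le (z := z') le_rfl hz' (le_refl j)
    have a2 := norm_geo_le (z := z') le_rfl hz' (le_refl (min j k))
    simp only [one_pow, mul_one] at a1 a2
    have a3 : ((min j k : ℕ) : ℝ) ≤ j := by exact_mod_cast min_le_left _ _
    linarith
  · rw [min_eq_left (by omega)] at h1 ⊢
    simpa using h1

theorem tendsto_tsum_truncErr (h : SpectralData R m e) {ε : ℝ} (hε : 0 < ε)
    (hs : Summable fun j : ℕ => (j : ℝ) ^ (1 + ε) * ‖R j‖) :
    Tendsto (fun k => ∑' j, truncErr (radius ε k) k j * ‖R j‖) atTop (nhds 0) := by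
  have hb : Summable fun j : ℕ =>
      (Real.exp 1 ^ ε * ((j : ℝ) ^ (1 + ε) * ‖R j‖) + 2 * ((j : ℝ) * ‖R j‖)) :=
    (hs.mul_left _).add (h.summable.mul_left _)
  have := tendsto_tsum_of_dominated_convergence (𝓕 := atTop) (G := ℝ)
    (f := fun k j => truncErr (radius ε k) k j * ‖R j‖) (g := fun _ => 0) hb ?_ ?_
  · simpa using this
  · intro j
    have h1 : Tendsto (fun k => (j : ℝ) * (radius ε k ^ j - 1) * ‖R j‖) atTop (nhds 0) := by
      have := ((((tendsto_radius ε).pow j).sub_const 1).const_mul (j : ℝ)).mul_const ‖R j‖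
      simpa using this
    refine h1.congr' ?_
    filter_upwards [eventually_ge_atTop j] with k hk
    simp [truncErr, hk]
  · filter_upwards [eventually_ge_atTop 1] with k hk j
    rcases Nat.eq_zero_or_pos j with rfl | hj
    · simp [h.zero]
    have hj0 : (0 : ℝ) < j := by exact_mod_cast hj
    have hr := one_le_radius hε.le hk
    rw [Real.norm_of_nonneg (mul_nonneg (truncErr_nonneg hr _ _) (norm_nonneg _))]
    have h1 := radius_pow_min_le hε.le hk hj
    rw [Real.mul_rpow (Real.exp_pos 1).le hj0.le] at h1
    have h2 : (if k < j then (2 : ℝ) else 0) ≤ 2 := by split_ifs <;> norm_num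
    have h3 : truncErr (radius ε k) k j ≤ j * (Real.exp 1 ^ ε * (j : ℝ) ^ ε + 2) := by
      unfold truncErr
      gcongr
      linarith
    rw [Real.rpow_add hj0, Real.rpow_one]
    calc _ ≤ j * (Real.exp 1 ^ ε * (j : ℝ) ^ ε + 2) * ‖R j‖ := by gcongr
      _ = _ := by ring

theorem summable_truncated (h : SpectralData R m e) (r : ℝ) (k : ℕ) :
    Summable fun j : ℕ => (((j : ℝ) + 1) * r ^ k) * ‖R j‖ := by
  simpa [mul_right_comm] using h.summable_add_one.mul_right (r ^ k)

theorem norm_pow_min_le {z : ℂ} {r : ℝ} (hr : 1 ≤ r) (hz : ‖z‖ ≤ r) (k j : ℕ) :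
    ‖z ^ min j k‖ ≤ ((j : ℝ) + 1) * r ^ k := by
  rw [norm_pow]
  have h1 : ‖z‖ ^ min j k ≤ r ^ k :=
    (pow_le_pow_left₀ (norm_nonneg _) hz _).trans (pow_le_pow_right₀ hr (min_le_right _ _))
  have h2 : (0 : ℝ) ≤ j * r ^ k := by positivity
  linarith

theorem norm_geo_min_le {z : ℂ} {r : ℝ} (hr : 1 ≤ r) (hz : ‖z‖ ≤ r) (k j : ℕ) :
    ‖geo z (min j k)‖ ≤ ((j : ℝ) + 1) * r ^ k := by
  refine (norm_geo_le hr hz (min_le_right j k)).trans ?_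
  gcongr
  have : ((min j k : ℕ) : ℝ) ≤ j := by exact_mod_cast min_le_left _ _
  linarith

/-- Uniform control of the regularized operators of the truncated return times. -/
theorem exists_bound_inverse_truncated [CompleteSpace B]
    (h : SpectralData R m e) {ε : ℝ} (hε : 0 < ε)
    (hs : Summable fun j : ℕ => (j : ℝ) ^ (1 + ε) * ‖R j‖) :
    ∃ K : ℝ, 0 < K ∧ ∀ᶠ k in atTop, ∀ z : ℂ, ‖z‖ ≤ radius ε k →
      IsUnit (regOp R m e (fun j => z ^ min j k) (fun j => geo z (min j k))) ∧
      ‖Ring.inverse (regOp R m e (fun j => z ^ min j k) (fun j => geo z (min j k)))‖ ≤ K := by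
  obtain ⟨K, hK, hb⟩ := h.exists_bound_inverse_regOp
  refine ⟨2 * K, by positivity, ?_⟩
  set κ := ‖1 - m.smulRight e‖ + ‖m‖ * ‖e‖
  have hκ : Tendsto (fun k => K * (κ * ∑' j, truncErr (radius ε k) k j * ‖R j‖)) atTop
      (nhds 0) := by
    simpa using ((h.tendsto_tsum_truncErr hε hs).const_mul κ).const_mul K
  filter_upwards [hκ.eventually_le_const (u := 1 / 2) (by norm_num), eventually_ge_atTop 1]
    with k hk hk1 z hz
  have hr := one_le_radius hε.le hk1
  obtain ⟨z', hz', hd⟩ := exists_norm_pow_sub_le hr hz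
  refine norm_inverse_le_of_norm_sub_le (h.isUnit_regOp hz') (hb z' hz') (le_trans ?_ hk)
  gcongr
  rw [norm_sub_rev]
  have hz1 : ‖z'‖ ≤ radius ε k := hz'.trans hr
  have hrk := one_le_pow₀ (n := k) hr
  refine norm_regOp_sub_le m e (h.summable_truncated _ k) ?_
    (norm_pow_min_le hr hz k) (fun j => ?_) (norm_geo_min_le hr hz k) (fun j => ?_)
    (norm_pow_min_sub_le hz' hd k) (norm_geo_min_sub_le hr hz' hd k)
  · refine h.summable_of_le (C := radius ε k ^ k + 1) (truncErr_nonneg hr k) fun j _ => ?_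
    rw [truncErr, mul_comm]
    refine mul_le_mul_of_nonneg_right ?_ (by positivity)
    have h2 : (if k < j then (2 : ℝ) else 0) ≤ 2 := by split_ifs <;> norm_num
    have h3 : radius ε k ^ min j k ≤ radius ε k ^ k :=
      pow_le_pow_right₀ hr (min_le_right _ _)
    linarith
  · rw [norm_pow]
    have a1 := pow_le_one₀ (n := j) (norm_nonneg z') hz'
    have : (0 : ℝ) ≤ j * radius ε k ^ k := by positivity
    linarith
  · have a1 := norm_geo_le (z := z') le_rfl hz' (le_refl j)
    simp only [one_pow, mul_one] at a1
    have : (j : ℝ) ≤ j * radius ε k ^ k := le_mul_of_one_le_right (by positivity) hrk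
    linarith

theorem differentiableOn_regOp_truncated [CompleteSpace B]
    (h : SpectralData R m e) {r : ℝ} (hr : 1 ≤ r) (k : ℕ) :
    DifferentiableOn ℂ (fun z : ℂ => regOp R m e (fun j => z ^ min j k)
      (fun j => geo z (min j k))) (Metric.ball 0 r) := by
  have hw : ∀ c : ℂ → ℕ → ℂ, (∀ j, Differentiable ℂ fun z => c z j) →
      (∀ z, ‖z‖ ≤ r → ∀ j, ‖c z j‖ ≤ ((j : ℝ) + 1) * r ^ k) →
      DifferentiableOn ℂ (fun z => wsum R (c z)) (Metric.ball 0 r) := by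
    intro c hc hb
    refine Complex.differentiableOn_tsum_of_summable_norm (h.summable_truncated r k)
      (fun j => ((hc j).smul_const _).differentiableOn) Metric.isOpen_ball fun j z hz => ?_
    rw [norm_smul]
    exact mul_le_mul_of_nonneg_right
      (hb z (by simpa using (mem_ball_zero_iff.1 hz).le) j) (norm_nonneg _)
  have h1 := hw (fun z j => z ^ min j k) (fun j => by fun_prop)
    fun z hz j => norm_pow_min_le hr hz k j
  have h2 := hw (fun z j => geo z (min j k)) (fun j => by unfold geo; fun_prop)
    fun z hz j => norm_geo_min_le hr hz k j
  unfold regOp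
  refine ((h1.const_sub 1).mul_const _).add ?_
  exact (ContinuousLinearMap.smulRightL ℂ B B m).differentiable.comp_differentiableOn
    (h2.clm_apply (differentiableOn_const e))

end SpectralData

theorem summable_mul_pow_of_bounded {a : ℕ → ℂ} {A : ℝ} (ha : ∀ t, ‖a t‖ ≤ A) {z : ℂ}
    (hz : ‖z‖ < 1) : Summable fun t => a t * z ^ t := by
  refine Summable.of_norm_bounded
    ((summable_geometric_of_lt_one (norm_nonneg z) hz).mul_left A) fun t => ?_
  rw [norm_mul, norm_pow]
  exact mul_le_mul_of_nonneg_right (ha t) (by positivity)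

/-- If `(1 - z) ∑ a_t z ^ t` extends to a bounded holomorphic function `h` on a disc of radius
larger than one, then `a_t` converges exponentially fast to `h 1`. -/
theorem norm_sub_le_of_generating_function {a : ℕ → ℂ} {A r ρ H : ℝ} {h : ℂ → ℂ}
    (ha : ∀ t, ‖a t‖ ≤ A) (hρ : 1 < ρ) (hr : ρ < r) (hd : DifferentiableOn ℂ h (Metric.ball 0 r))
    (hH : ∀ z ∈ Metric.ball (0 : ℂ) r, ‖h z‖ ≤ H)
    (heq : ∀ z : ℂ, ‖z‖ < 1 → (1 - z) * ∑' t, a t * z ^ t = h z) (t : ℕ) :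
    ‖a t - h 1‖ ≤ 2 * H / (ρ - 1) * ρ⁻¹ ^ t := by
  have hρ0 : 0 < ρ := by linarith
  have h1mem : (1 : ℂ) ∈ Metric.ball (0 : ℂ) r := by simpa using hρ.trans hr
  set g : ℂ → ℂ := dslope h 1
  have hg : DifferentiableOn ℂ g (Metric.ball 0 r) :=
    (Complex.differentiableOn_dslope (Metric.isOpen_ball.mem_nhds h1mem)).2 hd
  have hgval : ∀ z : ℂ, z ≠ 1 → g z = (z - 1)⁻¹ * (h z - h 1) := fun z hz => by
    simp [g, dslope_of_ne _ hz, slope_def_module]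
  set p := FormalMultilinearSeries.ofScalars ℂ (fun t => h 1 - a t)
  have hp : HasFPowerSeriesAt g p 0 := by
    rw [hasFPowerSeriesAt_iff]
    filter_upwards [Metric.ball_mem_nhds (0 : ℂ) one_pos] with z hz
    have hz1 : ‖z‖ < 1 := by simpa using hz
    have hne : z ≠ 1 := by rintro rfl; simp at hz1
    have hs1 := (summable_mul_pow_of_bounded ha hz1).hasSum
    have hs2 := (hasSum_geometric_of_norm_lt_one hz1).mul_left (h 1)
    have hs := hs2.sub hs1
    have hval : g (0 + z) = h 1 * (1 - z)⁻¹ - ∑' t, a t * z ^ t := by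
      rw [zero_add, hgval z hne, ← heq z hz1]
      have h3 : (1 : ℂ) - z ≠ 0 := sub_ne_zero.2 hne.symm
      have h4 : z - 1 ≠ 0 := sub_ne_zero.2 hne
      have h5 : (z - 1)⁻¹ = -(1 - z)⁻¹ := by rw [← inv_neg, neg_sub]
      rw [h5]
      field_simp
      ring
    rw [hval]
    refine hs.congr_fun fun n => ?_
    simp [p, FormalMultilinearSeries.coeff_ofScalars, mul_comm, mul_sub]
  have hcl : DifferentiableOn ℂ g (Metric.closedBall 0 (⟨ρ, hρ0.le⟩ : NNReal)) :=
    hg.mono (Metric.closedBall_subset_ball hr)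
  have hq := hcl.hasFPowerSeriesOnBall (R := ⟨ρ, hρ0.le⟩) (by exact_mod_cast hρ0)
  have hpq := hp.eq_formalMultilinearSeries hq.hasFPowerSeriesAt
  have hnorm : ‖p t‖ = ‖a t - h 1‖ := by
    have h1 : ‖p t‖ = ‖p.coeff t‖ := FormalMultilinearSeries.norm_apply_eq_norm_coef
    rw [h1, FormalMultilinearSeries.coeff_ofScalars, norm_sub_rev]
  rw [← hnorm, hpq]
  refine (norm_cauchyPowerSeries_le g 0 ρ t).trans ?_
  rw [abs_of_pos hρ0]
  refine mul_le_mul_of_nonneg_right ?_ (by positivity)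
  have hb : ∀ θ ∈ Set.uIoc 0 (2 * Real.pi), ‖‖g (circleMap 0 ρ θ)‖‖ ≤ 2 * H / (ρ - 1) := by
    intro θ _
    set z := circleMap 0 ρ θ
    have hz : ‖z‖ = ρ := by simp [z, abs_of_pos hρ0]
    have hne : z ≠ 1 := by intro h0; rw [h0] at hz; simp at hz; linarith
    have hzm : z ∈ Metric.ball (0 : ℂ) r := by simpa [hz] using hr
    have h4 : ρ - 1 ≤ ‖z - 1‖ := by
      have := norm_sub_norm_le z 1
      simpa [hz] using this
    rw [norm_norm, hgval z hne, norm_mul, norm_inv, inv_mul_eq_div]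
    have h5 : ‖h z - h 1‖ ≤ 2 * H := (norm_sub_le _ _).trans (by linarith [hH z hzm, hH 1 h1mem])
    have h6 : 0 < ρ - 1 := by linarith
    gcongr
    exact (norm_nonneg _).trans h5
  have h7 := intervalIntegral.norm_integral_le_of_norm_le_const hb
  rw [sub_zero, abs_of_pos (by positivity)] at h7
  have h8 := (le_abs_self _).trans h7
  calc _ ≤ (2 * Real.pi)⁻¹ * (2 * H / (ρ - 1) * (2 * Real.pi)) := by gcongr
    _ = _ := by field_simp

namespace SpectralData

variable {B : Type*} [NormedAddCommGroup B] [NormedSpace ℂ B] [CompleteSpace B]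
  {R : ℕ → B →L[ℂ] B} {m : B →L[ℂ] ℂ} {e : B}

/-- Exponential convergence of the solution `a` of a renewal equation with truncated return
times. -/
theorem renewal_limit (h : SpectralData R m e) {K r ρ C : ℝ} {k : ℕ} (hρ : 1 < ρ) (hr : ρ < r)
    (hr2 : r ≤ 2) (hC : 0 ≤ C)
    (hK : ∀ z : ℂ, ‖z‖ ≤ r →
      IsUnit (regOp R m e (fun j => z ^ min j k) (fun j => geo z (min j k))) ∧
      ‖Ring.inverse (regOp R m e (fun j => z ^ min j k) (fun j => geo z (min j k)))‖ ≤ K)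
    {a W : ℕ → B →L[ℂ] ℂ} (ha : ∀ t, ‖a t‖ ≤ C) (hW : ∀ l, ‖W l‖ ≤ C)
    (hren : ∀ z : ℂ, ‖z‖ < 1 → ∀ b, ∑' t, a t b * z ^ t =
      ∑ l ∈ Finset.range k, z ^ l * W l b +
        ∑' t, a t (wsum R (fun j => z ^ min j k) b) * z ^ t) (c : B) (t : ℕ) :
    ‖a t c * m (wsum R (fun j => ((min j k : ℕ) : ℂ)) e) -
      (∑ l ∈ Finset.range k, W l e) * m c‖ ≤
      ‖m (wsum R (fun j => ((min j k : ℕ) : ℂ)) e)‖ *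
      (2 * (k * r ^ k * (C * ((3 + 4 * (‖m‖ * ‖e‖)) * (K * ‖c‖)))) / (ρ - 1) * ρ⁻¹ ^ t) := by
  have hr1 : 1 < r := hρ.trans hr
  set M : ℂ → B →L[ℂ] B := fun z => regOp R m e (fun j => z ^ min j k) (fun j => geo z (min j k))
    with hM
  set x : ℂ → B := fun z => Ring.inverse (M z) c with hx
  set y : ℂ → B := fun z => (1 - z) • (x z - m (x z) • e) + m (x z) • e with hy
  set g : ℂ → ℂ := fun z => ∑ l ∈ Finset.range k, z ^ l * W l (y z) with hg
  have hMx : ∀ z, ‖z‖ ≤ r → M z (x z) = c := fun z hz => by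
    have := Ring.mul_inverse_cancel _ (hK z hz).1
    exact congrArg (fun f : B →L[ℂ] B => f c) this
  have hsum : ∀ z : ℂ, ‖z‖ < 1 → ∀ b, Summable fun t => a t b * z ^ t := fun z hz b =>
    summable_mul_pow_of_bounded (A := C * ‖b‖) (fun t => (a t).le_of_opNorm_le (ha t) b) hz
  have heq : ∀ z : ℂ, ‖z‖ < 1 → (1 - z) * ∑' t, a t c * z ^ t = g z := by
    intro z hz
    have h1 := h.one_sub_smul_regOp (h.summable_truncated r k)
      (norm_pow_min_le hr1.le (hz.le.trans hr1.le) k) (fun j => by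
        have h2 := one_le_pow₀ (n := k) hr1.le
        have h3 : (0 : ℝ) ≤ j * r ^ k := by positivity
        linarith) (x z)
    have h4 : regOp R m e (fun j => z ^ min j k) (fun j => geo z (min j k)) (x z) = c :=
      hMx z (hz.le.trans hr1.le)
    rw [h4] at h1
    have h5 := hren z hz (y z)
    have h6 : y z - wsum R (fun j => z ^ min j k) (y z) = (1 - z) • c := by
      rw [h1]; rfl
    rw [hg]
    simp only
    rw [← sub_eq_iff_eq_add, ← (hsum z hz _).tsum_sub (hsum z hz _)] at h5
    rw [← h5, ← tsum_mul_left]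
    refine tsum_congr fun t => ?_
    rw [← sub_mul, ← map_sub, h6, map_smul, smul_eq_mul]
    ring
  have hxd : DifferentiableOn ℂ x (Metric.ball 0 r) := by
    intro z hz
    have h1 := h.differentiableOn_regOp_truncated hr1.le k z hz
    have h2 := differentiableAt_inverse (𝕜 := ℂ) (hK z (mem_ball_zero_iff.1 hz).le).1
    exact (h2.comp_differentiableWithinAt z h1).clm_apply (differentiableWithinAt_const c)
  have hmx : DifferentiableOn ℂ (fun z => m (x z)) (Metric.ball 0 r) :=
    m.differentiable.comp_differentiableOn hxd
  have hyd : DifferentiableOn ℂ y (Metric.ball 0 r) :=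
    ((differentiableOn_const _).sub differentiableOn_id).smul (hxd.sub (hmx.smul_const e)) |>.add
      (hmx.smul_const e)
  have hgd : DifferentiableOn ℂ g (Metric.ball 0 r) := by
    refine DifferentiableOn.fun_sum fun l _ => ?_
    exact (differentiableOn_id.pow l).mul ((W l).differentiable.comp_differentiableOn hyd)
  have hgb : ∀ z ∈ Metric.ball (0 : ℂ) r,
      ‖g z‖ ≤ k * r ^ k * (C * ((3 + 4 * (‖m‖ * ‖e‖)) * (K * ‖c‖))) := by
    intro z hz
    have hzr : ‖z‖ ≤ r := (mem_ball_zero_iff.1 hz).le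
    have hxb : ‖x z‖ ≤ K * ‖c‖ := (Ring.inverse (M z)).le_of_opNorm_le (hK z hzr).2 c
    have hme : ‖m (x z) • e‖ ≤ ‖m‖ * ‖e‖ * (K * ‖c‖) := by
      rw [norm_smul]
      calc ‖m (x z)‖ * ‖e‖ ≤ (‖m‖ * (K * ‖c‖)) * ‖e‖ := by
            gcongr; exact m.le_opNorm_of_le hxb
        _ = _ := by ring
    have h1z : ‖1 - z‖ ≤ 3 := (norm_sub_le _ _).trans (by simp; linarith)
    have hyb : ‖y z‖ ≤ (3 + 4 * (‖m‖ * ‖e‖)) * (K * ‖c‖) := by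
      refine (norm_add_le _ _).trans ?_
      rw [norm_smul]
      have : ‖x z - m (x z) • e‖ ≤ K * ‖c‖ + ‖m‖ * ‖e‖ * (K * ‖c‖) :=
        (norm_sub_le _ _).trans (add_le_add hxb hme)
      calc _ ≤ 3 * (K * ‖c‖ + ‖m‖ * ‖e‖ * (K * ‖c‖)) + ‖m‖ * ‖e‖ * (K * ‖c‖) := by gcongr
        _ = _ := by ring
    refine (norm_sum_le _ _).trans ((Finset.sum_le_card_nsmul _ _
      (r ^ k * (C * ((3 + 4 * (‖m‖ * ‖e‖)) * (K * ‖c‖)))) fun l hl => ?_).trans ?_)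
    · rw [norm_mul, norm_pow]
      have hl' := (Finset.mem_range.1 hl).le
      have : ‖z‖ ^ l ≤ r ^ k :=
        (pow_le_pow_left₀ (norm_nonneg _) hzr _).trans (pow_le_pow_right₀ hr1.le hl')
      gcongr
      exact ((W l).le_of_opNorm_le (hW l) _).trans (by gcongr)
    · simp [mul_assoc]
  have key := norm_sub_le_of_generating_function (a := fun t => a t c) (A := C * ‖c‖)
    (fun t => (a t).le_of_opNorm_le (ha t) c) hρ hr hgd hgb heq t
  have hlim : g 1 * m (wsum R (fun j => ((min j k : ℕ) : ℂ)) e) =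
      (∑ l ∈ Finset.range k, W l e) * m c := by
    have h1 := hMx 1 (by simpa using hr1.le)
    have h2 : m (M 1 (x 1)) = m (x 1) * m (wsum R (fun j => ((min j k : ℕ) : ℂ)) e) := by
      simp only [hM]
      rw [regOp_apply]
      simp [geo, h.dual_fixed]
    rw [← h1, h2]
    simp only [hg, hy]
    simp [Finset.sum_mul]
    refine Finset.sum_congr rfl fun l _ => ?_
    ring
  rw [← hlim, ← sub_mul, norm_mul, mul_comm]
  exact mul_le_mul_of_nonneg_left key (norm_nonneg _)

end SpectralData

section Summation

theorem summable_of_tsum_normTail {B : Type*} [NormedAddCommGroup B] [NormedSpace ℂ B]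
    {R : ℕ → B →L[ℂ] B} {ε : ℝ} (hε : 0 < ε)
    (h : ∑' n : ℕ, ENNReal.ofReal (((n + 1 : ℕ) : ℝ) ^ ε) * normTail R (n + 1) < ∞) :
    Summable fun j : ℕ => (j : ℝ) ^ (1 + ε) * ‖R j‖ := by
  rw [← summable_nat_add_iff 2]
  set w : ℕ → ℝ≥0∞ := fun n => ENNReal.ofReal (((n + 1 : ℕ) : ℝ) ^ ε)
  set g : ℕ → ℝ≥0∞ := fun j => ENNReal.ofReal ‖R (j + 2)‖
  have h1 : ∑' n : ℕ, w n * normTail R (n + 1) = ∑' j, (∑ n ∈ Finset.range (j + 1), w n) * g j := by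
    have h2 : ∀ n, w n * normTail R (n + 1) = ∑' i, w n * g (n + i) := fun n => by
      rw [ENNReal.tsum_mul_left, normTail]
      congr 2
      ext i
      simp only [g]
      rw [show n + 1 + 1 + i = n + i + 2 by omega]
    simp only [h2]
    rw [← ENNReal.tsum_prod (f := fun n i => w n * g (n + i)),
      ← (Finset.HasAntidiagonal.sigmaAntidiagonalEquivProd (A := ℕ)).tsum_eq, ENNReal.tsum_sigma']
    refine tsum_congr fun j => ?_
    have h3 := Finset.Nat.sum_antidiagonal_eq_sum_range_succ_mk (M := ℝ≥0∞)
      (fun p => w p.1 * g j) j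
    rw [tsum_fintype, Finset.sum_mul, ← h3]
    refine (Finset.sum_congr rfl fun p _ => ?_).trans
      (Finset.sum_coe_sort (Finset.HasAntidiagonal.antidiagonal j) fun p => w p.1 * g j)
    have := Finset.HasAntidiagonal.mem_antidiagonal.1 p.2
    simp [Finset.HasAntidiagonal.sigmaAntidiagonalEquivProd, this]
  rw [h1] at h
  have h3 : ∀ j : ℕ, ENNReal.ofReal (4⁻¹ * 2⁻¹ ^ ε * ((((j + 2 : ℕ) : ℝ) ^ (1 + ε)) * ‖R (j + 2)‖))
      ≤ (∑ n ∈ Finset.range (j + 1), w n) * g j := by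
    intro j
    rw [← ENNReal.ofReal_sum_of_nonneg (fun _ _ => by positivity),
      ← ENNReal.ofReal_mul (by positivity)]
    refine ENNReal.ofReal_le_ofReal ?_
    rw [← mul_assoc]
    refine mul_le_mul_of_nonneg_right ?_ (norm_nonneg _)
    have h4 : ∑ n ∈ Finset.Ico ((j + 1) / 2) (j + 1), ((((j + 2 : ℕ) : ℝ) / 2)) ^ ε
        ≤ ∑ n ∈ Finset.range (j + 1), ((n + 1 : ℕ) : ℝ) ^ ε := by
      refine (Finset.sum_le_sum (g := fun n : ℕ => ((n + 1 : ℕ) : ℝ) ^ ε) fun n hn => ?_).trans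
        (Finset.sum_le_sum_of_subset_of_nonneg ?_ fun _ _ _ => by positivity)
      · have hn' := (Finset.mem_Ico.1 hn).1
        have : ((j + 2 : ℕ) : ℝ) ≤ 2 * ((n + 1 : ℕ) : ℝ) := by
          exact_mod_cast (by omega : j + 2 ≤ 2 * (n + 1))
        refine Real.rpow_le_rpow (by positivity) (by linarith) hε.le
      · intro n hn
        exact Finset.mem_range.2 (Finset.mem_Ico.1 hn).2
    refine le_trans ?_ h4
    rw [Finset.sum_const, Nat.card_Ico, nsmul_eq_mul]
    have h5 : ((j + 2 : ℕ) : ℝ) ≤ 4 * ((j + 1 - (j + 1) / 2 : ℕ) : ℝ) := by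
      exact_mod_cast (by omega : j + 2 ≤ 4 * (j + 1 - (j + 1) / 2))
    rw [div_eq_mul_inv, Real.mul_rpow (by positivity) (by positivity),
      Real.rpow_add (by positivity), Real.rpow_one]
    have h6 : (0 : ℝ) ≤ ((j + 2 : ℕ) : ℝ) ^ ε * 2⁻¹ ^ ε := by positivity
    nlinarith
  have h7 := lt_of_le_of_lt (ENNReal.tsum_le_tsum h3) h
  have h8 : Summable fun j : ℕ =>
      4⁻¹ * 2⁻¹ ^ ε * ((((j + 2 : ℕ) : ℝ) ^ (1 + ε)) * ‖R (j + 2)‖) := by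
    refine (ENNReal.summable_toReal h7.ne).congr fun j => ?_
    rw [ENNReal.toReal_ofReal (by positivity)]
  exact (summable_mul_left_iff (by positivity)).1 h8

end Summation

section Duality

variable {Y : Type*} [MeasurableSpace Y] {F : Y → Y} {φ : Y → ℕ} {μ : Measure Y}
  {B : Type*} [NormedAddCommGroup B] [NormedSpace ℂ B] {ι : B →ₗ[ℂ] Lp ℂ 1 μ} {R : ℕ → B →L[ℂ] B}

theorem integrable_mul_of_bounded {f g : Y → ℂ} (hf : Integrable f μ) (hg : Measurable g) {C : ℝ}
    (hC : ∀ y, ‖g y‖ ≤ C) : Integrable (fun y => g y * f y) μ :=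
  hf.bdd_mul hg.aestronglyMeasurable (ae_of_all _ hC)

theorem exists_pairing [IsProbabilityMeasure μ]
    (hι : ∀ b, ‖ι b‖ ≤ ‖b‖) {g : Y → ℂ} (hg : Measurable g) {C : ℝ}
    (h0 : 0 ≤ C) (hC : ∀ y, ‖g y‖ ≤ C) :
    ∃ L : B →L[ℂ] ℂ, (∀ b, L b = ∫ y, g y * ι b y ∂μ) ∧ ‖L‖ ≤ C := by
  have hint : ∀ b, Integrable (fun y => g y * ι b y) μ := fun b =>
    integrable_mul_of_bounded (L1.integrable_coeFn _) hg hC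
  let l : B →ₗ[ℂ] ℂ :=
    { toFun := fun b => ∫ y, g y * ι b y ∂μ
      map_add' := fun b c => by
        rw [← integral_add (hint b) (hint c)]
        refine integral_congr_ae ?_
        rw [map_add]
        filter_upwards [Lp.coeFn_add (ι b) (ι c)] with y hy
        rw [hy, Pi.add_apply, mul_add]
      map_smul' := fun a b => by
        rw [RingHom.id_apply, smul_eq_mul, ← integral_const_mul]
        refine integral_congr_ae ?_
        rw [map_smul]
        filter_upwards [Lp.coeFn_smul a (ι b)] with y hy
        rw [hy, Pi.smul_apply, smul_eq_mul]
        ring }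
  have hb : ∀ b, ‖l b‖ ≤ C * ‖b‖ := fun b => by
    calc ‖l b‖ ≤ ∫ y, ‖g y * ι b y‖ ∂μ := norm_integral_le_integral_norm _
      _ ≤ ∫ y, C * ‖ι b y‖ ∂μ := by
          refine integral_mono (hint b).norm ((L1.integrable_coeFn _).norm.const_mul C) fun y => ?_
          simp only [norm_mul]
          exact mul_le_mul_of_nonneg_right (hC y) (norm_nonneg _)
      _ = C * ‖ι b‖ := by rw [integral_const_mul, L1.norm_eq_integral_norm]
      _ ≤ C * ‖b‖ := by gcongr; exact hι b
  exact ⟨l.mkContinuous C hb, fun b => rfl, l.mkContinuous_norm_le h0 hb⟩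

theorem integral_mul_transfer [IsProbabilityMeasure μ]
    (hF : MeasurePreserving F μ μ) {f : Y → ℂ} (hf : Integrable f μ)
    {g : Y → ℂ} (hg : Measurable g) {C : ℝ} (hC : ∀ y, ‖g y‖ ≤ C) :
    ∫ y, g y * transfer F μ f y ∂μ = ∫ y, g (F y) * f y ∂μ := by
  have h1 := integral_smul_transfer hF hf (w := fun y => (g y).re) (by fun_prop) (C := C)
    fun y => (Complex.abs_re_le_norm _).trans (hC y)
  have h2 := integral_smul_transfer hF hf (w := fun y => (g y).im) (by fun_prop) (C := C)
    fun y => (Complex.abs_im_le_norm _).trans (hC y)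
  have key : ∀ (u : Y → ℂ) (f : Y → ℂ), Measurable u → (∀ y, ‖u y‖ ≤ C) → Integrable f μ →
      ∫ y, u y * f y ∂μ = ∫ y, (u y).re • f y ∂μ + Complex.I * ∫ y, (u y).im • f y ∂μ := by
    intro u f hu huC hf
    rw [← integral_const_mul, ← integral_add]
    · refine integral_congr_ae (ae_of_all _ fun y => ?_)
      simp only [Complex.real_smul]
      conv_lhs => rw [← Complex.re_add_im (u y)]
      ring
    · exact hf.bdd_smul C (Measurable.aestronglyMeasurable
        (f := fun y => (u y).re) (by fun_prop)) (ae_of_all _ fun y =>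
        (Complex.abs_re_le_norm _).trans (huC y))
    · exact (hf.bdd_smul C (Measurable.aestronglyMeasurable
        (f := fun y => (u y).im) (by fun_prop)) (ae_of_all _ fun y =>
        (Complex.abs_im_le_norm _).trans (huC y))).const_mul _
  rw [key g _ hg hC (integrable_transfer _ _ _), h1, h2,
    key (fun y => g (F y)) f (hg.comp hF.measurable) (fun y => hC _) hf]

theorem integral_mul_wsum [IsProbabilityMeasure μ] [CompleteSpace B] (hι : ∀ b, ‖ι b‖ ≤ ‖b‖)
    (hren : IsRenewalOperators F φ μ ι R)
    (hF : MeasurePreserving F μ μ) (hφ : Measurable φ) {g : Y → ℂ} (hg : Measurable g) {C : ℝ}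
    (hC : ∀ y, ‖g y‖ ≤ C) {c : ℕ → ℂ} {G : ℕ → ℝ} (hG : Summable fun j => G j * ‖R j‖)
    (hc : ∀ j, ‖c j‖ ≤ G j) {b : B} (hint : Integrable (fun y => c (φ y) * ι b y) μ) :
    ∫ y, g y * ι (wsum R c b) y ∂μ = ∫ y, g (F y) * (c (φ y) * ι b y) ∂μ := by
  have hC0 : 0 ≤ C := by
    obtain ⟨y⟩ : Nonempty Y := μ.nonempty_of_neZero
    exact (norm_nonneg _).trans (hC y)
  obtain ⟨L, hL, -⟩ := exists_pairing hι hg hC0 hC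
  rw [← hL]
  have h1 : HasSum (fun j => c j • R j) (wsum R c) := (summable_smul_of_le hG hc).hasSum
  have h2 := (L.hasSum ((ContinuousLinearMap.apply ℂ B b).hasSum h1))
  refine h2.unique ?_
  have hs : ∀ j, MeasurableSet {y | φ y = j} := fun j => hφ (measurableSet_singleton j)
  have hu : (⋃ j, {y | φ y = j}) = univ := by ext y; simp
  have hint' : Integrable (fun y => g (F y) * (c (φ y) * ι b y)) μ :=
    integrable_mul_of_bounded hint (hg.comp hF.measurable) fun y => hC _
  have h3 := hasSum_integral_iUnion (f := fun y => g (F y) * (c (φ y) * ι b y)) hs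
    (fun i j hij => Set.disjoint_left.2 fun y hi hj => hij (hi.symm.trans hj))
    (hint'.integrableOn)
  rw [hu, setIntegral_univ] at h3
  refine h3.congr_fun fun j => ?_
  simp only [ContinuousLinearMap.apply_apply, map_smul, smul_eq_mul]
  rw [hL]
  have h4 : ∫ y, g y * ι (R j b) y ∂μ =
      ∫ y, g y * transfer F μ ({y | φ y = j}.indicator (ι b)) y ∂μ := by
    refine integral_congr_ae ?_
    filter_upwards [hren j b] with y hy
    rw [hy]
  rw [h4, integral_mul_transfer hF ((L1.integrable_coeFn _).indicator (hs j)) hg hC,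
    ← integral_const_mul, ← integral_indicator (hs j)]
  refine integral_congr_ae (ae_of_all _ fun y => ?_)
  by_cases hy : φ y = j
  · simp [Set.indicator, hy]; ring
  · simp [Set.indicator, hy]

theorem ae_eq_of_integral_mul_eq {f g : Y → ℂ} (hf : Integrable f μ) (hg : Integrable g μ)
    (h : ∀ A : Set Y, MeasurableSet A →
      ∫ y, A.indicator 1 y * f y ∂μ = ∫ y, A.indicator 1 y * g y ∂μ) : f =ᵐ[μ] g := by
  refine hf.ae_eq_of_forall_setIntegral_eq f g hg fun A hA _ => ?_
  have := h A hA
  rw [← integral_indicator hA, ← integral_indicator hA]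
  have e1 : ∀ f : Y → ℂ, (fun y => A.indicator (1 : Y → ℂ) y * f y) = A.indicator f := fun f => by
    ext y; by_cases hy : y ∈ A <;> simp [hy]
  rwa [e1, e1] at this

theorem renewalOperators_zero [IsProbabilityMeasure μ]
    (hι : Function.Injective ι) (hren : IsRenewalOperators F φ μ ι R)
    (hF : MeasurePreserving F μ μ) (h1 : ∀ y, 1 ≤ φ y) : R 0 = 0 := by
  ext b
  apply hι
  rw [zero_apply, map_zero]
  apply Lp.ext
  refine EventuallyEq.trans ?_ (Lp.coeFn_zero ℂ 1 μ).symm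
  refine (hren 0 b).trans ?_
  have he : {y | φ y = 0} = ∅ := by
    ext y
    have := h1 y
    exact iff_of_false (fun h => by rw [mem_ofPred_eq] at h; omega) (notMem_empty y)
  rw [he, Set.indicator_empty, show (fun _ : Y => (0 : ℂ)) = 0 from rfl]
  refine ae_eq_of_integral_mul_eq (integrable_transfer _ _ _) (integrable_zero _ _ _)
    fun A hA => ?_
  have := integral_mul_transfer hF (integrable_zero _ _ _) (g := A.indicator 1) (C := 1)
    (measurable_const.indicator hA) fun y => by by_cases hy : y ∈ A <;> simp [hy]
  simpa using this

theorem renewalSeries_eq_wsum [CompleteSpace B] (hR : Summable fun j => ‖R j‖) (h0 : R 0 = 0)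
    {z : ℂ} (hz : ‖z‖ ≤ 1) : renewalSeries R z = wsum R (fun j => z ^ j) := by
  have hs : Summable fun j => z ^ j • R j :=
    summable_smul_of_le (G := fun _ => 1) (by simpa using hR) fun j => by
      rw [norm_pow]; exact pow_le_one₀ (norm_nonneg _) hz
  rw [wsum, hs.tsum_eq_zero_add, h0, smul_zero, zero_add]
  rfl

theorem spectralData_of_isGood [IsProbabilityMeasure μ]
    (hF : MeasurePreserving F μ μ) (hφ : Measurable φ)
    (h1 : ∀ y, 1 ≤ φ y) (hφi : Integrable (fun y => (φ y : ℝ)) μ) (hgood : IsGood F φ μ ι R)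
    (hs : Summable fun j : ℕ => (j : ℝ) * ‖R j‖) {m : B →L[ℂ] ℂ} (hm : ∀ b, m b = ∫ y, ι b y ∂μ)
    {e : B} (he : ι e =ᵐ[μ] fun _ => 1) : SpectralData R m e := by
  have := hgood.space.complete
  have hι := hgood.space.norm_le
  have h0 := renewalOperators_zero hgood.space.injective hgood.renewal hF h1
  have hR : Summable fun j => 1 * ‖R j‖ := by
    refine Summable.of_nonneg_of_le (fun j => by positivity) (fun j => ?_) hs
    rcases Nat.eq_zero_or_pos j with rfl | hj
    · simp [h0]
    · gcongr
      exact_mod_cast hj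
  have hR' : Summable fun j => ‖R j‖ := by simpa using hR
  have hone : renewalSeries R 1 = wsum R (fun _ => 1) := by
    rw [renewalSeries_eq_wsum hR' h0 (by simp)]
    simp
  have dual := fun (g : Y → ℂ) (hg : Measurable g) (hC : ∀ y, ‖g y‖ ≤ 1) (b : B) =>
    integral_mul_wsum hι hgood.renewal hF hφ hg hC (c := fun _ => 1) hR (by simp) (b := b)
      (by simpa using L1.integrable_coeFn (ι b))
  refine ⟨hs, h0, ?_, ?_, fun b => ?_, ?_, ?_, fun z hz hz1 => ?_, ?_⟩
  · rw [hm, integral_congr_ae he]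
    simp
  · apply hgood.space.injective
    apply Lp.ext
    refine ae_eq_of_integral_mul_eq (L1.integrable_coeFn _) (L1.integrable_coeFn _) fun A hA => ?_
    have hb : ∀ y, ‖A.indicator (1 : Y → ℂ) y‖ ≤ 1 := fun y => by
      by_cases hy : y ∈ A <;> simp [hy]
    have hmeas : Measurable (A.indicator (1 : Y → ℂ)) := measurable_const.indicator hA
    rw [dual _ hmeas hb]
    have e1 : ∫ y, A.indicator (1 : Y → ℂ) (F y) * (1 * ι e y) ∂μ
        = ∫ y, A.indicator (1 : Y → ℂ) (F y) ∂μ := by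
      refine integral_congr_ae ?_
      filter_upwards [he] with y hy
      rw [hy]; simp
    have e2 : ∫ y, A.indicator (1 : Y → ℂ) y * ι e y ∂μ
        = ∫ y, A.indicator (1 : Y → ℂ) y ∂μ := by
      refine integral_congr_ae ?_
      filter_upwards [he] with y hy
      rw [hy]; simp
    rw [e1, e2]
    have := integral_map (μ := μ) (f := A.indicator (1 : Y → ℂ)) hF.measurable.aemeasurable
      hmeas.aestronglyMeasurable
    rw [hF.map_eq] at this
    exact this.symm
  · have := dual (fun _ => 1) measurable_const (by simp) b
    simpa [hm] using this
  · rw [← hone]; exact hgood.simple_isolated.1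
  · rw [← hone]; exact hgood.simple_isolated.2.1
  · have h2 := hgood.aperiodic z hz hz1
    rw [spectrum.notMem_iff, map_one, renewalSeries_eq_wsum hR' h0 hz] at h2
    exact h2
  · have hphi : (fun y => (φ y : ℂ) * ι e y) =ᵐ[μ] fun y => ((φ y : ℝ) : ℂ) := by
      filter_upwards [he] with y hy
      rw [hy]; simp
    have h3 := integral_mul_wsum hι hgood.renewal hF hφ (g := fun _ => 1) measurable_const (C := 1)
      (by simp) (c := fun j => (j : ℂ)) (G := fun j => (j : ℝ)) hs (by simp) (b := e)
      (hφi.ofReal.congr hphi.symm)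
    simp only [one_mul] at h3
    rw [hm, h3, integral_congr_ae hphi, integral_complex_ofReal]
    have h4 : (1 : ℝ) ≤ ∫ y, (φ y : ℝ) ∂μ := by
      have := integral_mono (μ := μ) (integrable_const (1 : ℝ)) hφi fun y => by
        simpa using h1 y
      simpa using this
    intro h5
    have h6 : (∫ y, (φ y : ℝ) ∂μ) = 0 := by exact_mod_cast h5
    linarith

end Duality

section ColumnSums

variable {Y : Type*} [MeasurableSpace Y] {μ : Measure Y} {E : Type*}

theorem measurable_column_sum [AddCommMonoid E] [MeasurableSpace E] [MeasurableAdd₂ E]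
    {p : Y → ℕ} (hp : Measurable p) {h : ℕ → Y → E} (hh : ∀ l, Measurable (h l)) :
    Measurable fun y => ∑ l ∈ Finset.range (p y), h l y := by
  have h1 : Measurable fun q : ℕ × Y => ∑ l ∈ Finset.range q.1, h l q.2 :=
    measurable_from_prod_countable_right
      fun n => Finset.measurable_sum (Finset.range n) fun l _ => hh l
  exact h1.comp (hp.prodMk measurable_id)

theorem norm_column_sum_le [SeminormedAddCommGroup E] {p : ℕ} {h : ℕ → E} {C : ℝ}
    (hC : ∀ l, ‖h l‖ ≤ C) : ‖∑ l ∈ Finset.range p, h l‖ ≤ C * p := by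
  refine (norm_sum_le _ _).trans ((Finset.sum_le_card_nsmul _ _ C fun l _ => hC l).trans ?_)
  simp [mul_comm]

theorem integrable_column_sum {p : Y → ℕ} (hp : Measurable p)
    (hpi : Integrable (fun y => (p y : ℝ)) μ) {h : ℕ → Y → ℝ} (hh : ∀ l, Measurable (h l))
    {C : ℝ} (hC : ∀ l y, |h l y| ≤ C) :
    Integrable (fun y => ∑ l ∈ Finset.range (p y), h l y) μ :=
  (hpi.const_mul C).mono' (measurable_column_sum hp hh).aestronglyMeasurable
    (ae_of_all _ fun y => norm_column_sum_le fun l => hC l y)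

theorem sum_range_eq_sum_ite [AddCommMonoid E] {p k : ℕ} (h : p ≤ k) (f : ℕ → E) :
    ∑ l ∈ Finset.range p, f l = ∑ l ∈ Finset.range k, if l < p then f l else 0 := by
  rw [← Finset.sum_filter]
  congr 1
  ext l
  simp only [Finset.mem_range, Finset.mem_filter]
  omega

end ColumnSums

section TowerOrbit

variable {Y : Type*}

/-- The tower map over the base map `F` with heights `ψ`. -/
def towerMap (F : Y → Y) (ψ : Y → ℕ) (p : Y × ℕ) : Y × ℕ :=
  if p.2 + 1 < ψ p.1 then (p.1, p.2 + 1) else (F p.1, 0)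

/-- The orbit of the base point `(y, 0)` under the tower map. -/
def towerOrbit (F : Y → Y) (ψ : Y → ℕ) (t : ℕ) (y : Y) : Y × ℕ := (towerMap F ψ)^[t] (y, 0)

variable {F : Y → Y} {ψ : Y → ℕ}

theorem towerOrbit_succ (t : ℕ) (y : Y) :
    towerOrbit F ψ (t + 1) y = towerMap F ψ (towerOrbit F ψ t y) :=
  Function.iterate_succ_apply' _ _ _

theorem towerOrbit_of_lt {t : ℕ} {y : Y} (ht : t < ψ y) : towerOrbit F ψ t y = (y, t) := by
  induction t with
  | zero => rfl
  | succ t ih => rw [towerOrbit_succ, ih (by omega), towerMap, if_pos ht]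

theorem towerOrbit_add (hψ : ∀ y, 1 ≤ ψ y) (y : Y) (s : ℕ) :
    towerOrbit F ψ (ψ y + s) y = towerOrbit F ψ s (F y) := by
  have h1 : towerOrbit F ψ (ψ y) y = (F y, 0) := by
    have h2 := hψ y
    obtain ⟨t, ht⟩ : ∃ t, ψ y = t + 1 := ⟨ψ y - 1, by omega⟩
    rw [ht, towerOrbit_succ, towerOrbit_of_lt (by omega), towerMap, if_neg (by simp [ht])]
  rw [towerOrbit, add_comm, Function.iterate_add_apply]
  exact congrArg _ h1

theorem towerOrbit_snd_lt (hψ : ∀ y, 1 ≤ ψ y) (t : ℕ) (y : Y) :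
    (towerOrbit F ψ t y).2 < ψ (towerOrbit F ψ t y).1 := by
  induction t with
  | zero => exact hψ y
  | succ t ih =>
    rw [towerOrbit_succ, towerMap]
    split_ifs with h
    · exact h
    · exact hψ _

theorem measurable_towerOrbit [MeasurableSpace Y] (hF : Measurable F) (hψ : Measurable ψ) (t : ℕ) :
    Measurable (towerOrbit F ψ t) := by
  have h1 : Measurable (towerMap F ψ) := by
    unfold towerMap
    refine Measurable.ite ?_ (by fun_prop) (by fun_prop)
    exact measurableSet_lt (by fun_prop) (by fun_prop)
  exact (h1.iterate t).comp (measurable_id.prodMk measurable_const)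

/-- Pointwise renewal equation for the generating function of an observable along the orbit. -/
theorem tsum_towerOrbit (hψ : ∀ y, 1 ≤ ψ y) {f : Y × ℕ → ℝ} {C : ℝ} (hC : ∀ p, |f p| ≤ C) {z : ℂ}
    (hz : ‖z‖ < 1) (y : Y) :
    ∑' t, (f (towerOrbit F ψ t y) : ℂ) * z ^ t =
      ∑ l ∈ Finset.range (ψ y), z ^ l * (f (y, l) : ℂ) +
        z ^ ψ y * ∑' t, (f (towerOrbit F ψ t (F y)) : ℂ) * z ^ t := by
  have hs : Summable fun t => (f (towerOrbit F ψ t y) : ℂ) * z ^ t :=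
    summable_mul_pow_of_bounded (A := C) (fun t => by simpa using hC _) hz
  rw [← hs.sum_add_tsum_nat_add (ψ y), ← tsum_mul_left]
  congr 1
  · refine Finset.sum_congr rfl fun l hl => ?_
    rw [towerOrbit_of_lt (Finset.mem_range.1 hl), mul_comm]
  · refine tsum_congr fun t => ?_
    rw [add_comm t, towerOrbit_add hψ, pow_add]
    ring

end TowerOrbit

section Renewal

variable {Y : Type*} [MeasurableSpace Y] {F : Y → Y} {φ : Y → ℕ} {μ : Measure Y}
  {B : Type*} [NormedAddCommGroup B] [NormedSpace ℂ B] {ι : B →ₗ[ℂ] Lp ℂ 1 μ} {R : ℕ → B →L[ℂ] B}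

theorem renewal_equation [IsProbabilityMeasure μ] [CompleteSpace B] (hι : ∀ b, ‖ι b‖ ≤ ‖b‖)
    (hren : IsRenewalOperators F φ μ ι R) (hF : MeasurePreserving F μ μ) (hφ : Measurable φ)
    (h1 : ∀ y, 1 ≤ φ y) (hR : Summable fun j => ‖R j‖) {k : ℕ} (hk : 1 ≤ k)
    {f : Y × ℕ → ℝ} (hf : Measurable f) {C : ℝ} (hC : ∀ p, |f p| ≤ C)
    {a W : ℕ → B →L[ℂ] ℂ}
    (ha : ∀ t b, a t b = ∫ y, (f (towerOrbit F (fun y => min (φ y) k) t y) : ℂ) * ι b y ∂μ)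
    (hW : ∀ l b, W l b = ∫ y, ((if l < min (φ y) k then f (y, l) else 0 : ℝ) : ℂ) * ι b y ∂μ)
    {z : ℂ} (hz : ‖z‖ < 1) (b : B) :
    ∑' t, a t b * z ^ t = ∑ l ∈ Finset.range k, z ^ l * W l b +
        ∑' t, a t (wsum R (fun j => z ^ min j k) b) * z ^ t := by
  set ψ : Y → ℕ := fun y => min (φ y) k with hψdef
  have hψ : ∀ y, 1 ≤ ψ y := fun y => le_min (h1 y) hk
  have hψm : Measurable ψ := hφ.min measurable_const
  have hC0 : 0 ≤ C := by
    obtain ⟨y⟩ : Nonempty Y := μ.nonempty_of_neZero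
    exact (abs_nonneg _).trans (hC (y, 0))
  have hαm : ∀ t, Measurable fun y => (f (towerOrbit F ψ t y) : ℂ) := fun t =>
    Complex.measurable_ofReal.comp (hf.comp (measurable_towerOrbit hF.measurable hψm t))
  have hαb : ∀ t y, ‖(f (towerOrbit F ψ t y) : ℂ)‖ ≤ C := fun t y => by simpa using hC _
  set g : Y → ℂ := fun y => ∑' t, (f (towerOrbit F ψ t y) : ℂ) * z ^ t with hg
  have hgs : ∀ y, Summable fun t => (f (towerOrbit F ψ t y) : ℂ) * z ^ t := fun y =>
    summable_mul_pow_of_bounded (fun t => hαb t y) hz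
  have hgm : Measurable g := by
    refine measurable_of_tendsto_metrizable (f := fun n y =>
      ∑ t ∈ Finset.range n, (f (towerOrbit F ψ t y) : ℂ) * z ^ t) (fun n => ?_) ?_
    · exact Finset.measurable_sum _ fun t _ => (hαm t).mul_const _
    · exact tendsto_pi_nhds.2 fun y => (hgs y).hasSum.tendsto_sum_nat
  have hgeo := (summable_geometric_of_lt_one (norm_nonneg z) hz).mul_left C
  have hgb : ∀ y, ‖g y‖ ≤ ∑' t, C * ‖z‖ ^ t := fun y =>
    tsum_of_norm_bounded hgeo.hasSum fun t => by
      rw [norm_mul, norm_pow]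
      exact mul_le_mul_of_nonneg_right (hαb t y) (by positivity)
  have hswap : ∀ b, ∑' t, a t b * z ^ t = ∫ y, g y * ι b y ∂μ := by
    intro b
    have hi : ∀ t, Integrable (fun y => ((f (towerOrbit F ψ t y) : ℂ) * z ^ t) * ι b y) μ :=
      fun t => integrable_mul_of_bounded (C := C * ‖z‖ ^ t) (L1.integrable_coeFn _)
        ((hαm t).mul_const _) fun y => by
          rw [norm_mul, norm_pow]
          exact mul_le_mul_of_nonneg_right (hαb t y) (by positivity)
    have hs : Summable fun t => ∫ y, ‖((f (towerOrbit F ψ t y) : ℂ) * z ^ t) * ι b y‖ ∂μ := by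
      refine Summable.of_nonneg_of_le (fun t => integral_nonneg fun _ => norm_nonneg _)
        (fun t => ?_) (hgeo.mul_right (∫ y, ‖ι b y‖ ∂μ))
      rw [← integral_const_mul]
      refine integral_mono (hi t).norm ((L1.integrable_coeFn _).norm.const_mul _) fun y => ?_
      simp only [norm_mul, norm_pow]
      gcongr
      simpa using hαb t y
    have h3 := integral_tsum_of_summable_integral_norm hi hs
    calc ∑' t, a t b * z ^ t
        = ∑' t, ∫ y, ((f (towerOrbit F ψ t y) : ℂ) * z ^ t) * ι b y ∂μ := by
          refine tsum_congr fun t => ?_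
          rw [ha, ← integral_mul_const]
          refine integral_congr_ae (ae_of_all _ fun y => ?_)
          simp only
          ring
      _ = _ := by
          rw [h3]
          refine integral_congr_ae (ae_of_all _ fun y => ?_)
          simp only [hg]
          rw [tsum_mul_right]
  have hzb : ∀ n : ℕ, ‖z ^ n‖ ≤ 1 := fun n => by
    rw [norm_pow]; exact pow_le_one₀ (norm_nonneg _) hz.le
  have hzm : Measurable fun y => z ^ min (φ y) k :=
    (measurable_from_nat (f := fun n => z ^ n)).comp hψm
  have hint : Integrable (fun y => z ^ min (φ y) k * ι b y) μ :=
    integrable_mul_of_bounded (L1.integrable_coeFn _) hzm fun y => hzb _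
  have hdual := integral_mul_wsum hι hren hF hφ hgm hgb (c := fun j => z ^ min j k)
    (G := fun _ => 1) (by simpa using hR) (fun j => hzb _) (b := b) hint
  rw [hswap, hswap, hdual]
  have hWi : ∀ l, Integrable (fun y =>
      ((if l < min (φ y) k then f (y, l) else 0 : ℝ) : ℂ) * ι b y) μ := fun l => by
    refine integrable_mul_of_bounded (C := C) (L1.integrable_coeFn _) ?_ fun y => ?_
    · refine Complex.measurable_ofReal.comp (Measurable.ite ?_ ?_ measurable_const)
      · exact measurableSet_lt measurable_const hψm
      · exact hf.comp (measurable_id.prodMk measurable_const)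
    · split_ifs
      · simpa using hC _
      · simpa using hC0
  have hsum : ∑ l ∈ Finset.range k, z ^ l * W l b = ∫ y, ∑ l ∈ Finset.range k,
      z ^ l * (((if l < min (φ y) k then f (y, l) else 0 : ℝ) : ℂ) * ι b y) ∂μ := by
    rw [integral_finsetSum _ fun l _ => (hWi l).const_mul _]
    refine Finset.sum_congr rfl fun l _ => ?_
    rw [hW, integral_const_mul]
  rw [hsum, ← integral_add]
  · refine integral_congr_ae (ae_of_all _ fun y => ?_)
    have h4 := tsum_towerOrbit (F := F) hψ hC hz y
    simp only [hg] at h4 ⊢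
    rw [h4, sum_range_eq_sum_ite (min_le_right (φ y) k), add_mul, Finset.sum_mul]
    congr 1
    · refine Finset.sum_congr rfl fun l _ => ?_
      split_ifs <;> simp [mul_assoc]
    · ring
  · exact integrable_finsetSum _ fun l _ => (hWi l).const_mul _
  · exact integrable_mul_of_bounded hint (hgm.comp hF.measurable) fun y => hgb _

end Renewal

section TruncatedCorrelation

variable {Y : Type*} [MeasurableSpace Y] {F : Y → Y} {φ : Y → ℕ} {μ : Measure Y}
  {B : Type*} [NormedAddCommGroup B] [NormedSpace ℂ B] {ι : B →ₗ[ℂ] Lp ℂ 1 μ} {R : ℕ → B →L[ℂ] B}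

/-- The values of `g` at the points of the tower of height `min p k` at distance `i + 1` from the
top. -/
def fromTop (g : ℕ → ℝ) (p k i : ℕ) : ℝ := if i + 1 ≤ p then g (min p k - (i + 1)) else g 0

theorem sum_fromTop (g H : ℕ → ℝ) (p k : ℕ) :
    ∑ i ∈ Finset.range k, H i * ((if i + 1 ≤ p then 1 else 0) * fromTop g p k i) =
      ∑ l ∈ Finset.range (min p k), g l * H (min p k - 1 - l) := by
  rw [← Finset.sum_range_reflect (fun l => g l * H (min p k - 1 - l)) (min p k),
    sum_range_eq_sum_ite (min_le_right p k)]
  refine Finset.sum_congr rfl fun i hi => ?_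
  have hik := Finset.mem_range.1 hi
  by_cases h : i + 1 ≤ p
  · have h2 : i < min p k := by omega
    rw [if_pos h, if_pos h2, fromTop, if_pos h, show min p k - 1 - (min p k - 1 - i) = i by omega,
      show min p k - (i + 1) = min p k - 1 - i by omega]
    ring
  · have h2 : ¬ i < min p k := by omega
    rw [if_neg h, if_neg h2]
    ring

theorem measurable_fromTop (hφ : Measurable φ) {g : Y × ℕ → ℝ} (hg : Measurable g) (k i : ℕ) :
    Measurable fun y => fromTop (fun l => g (y, l)) (φ y) k i := by
  unfold fromTop
  refine Measurable.ite (measurableSet_le measurable_const hφ) ?_ (by fun_prop)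
  exact hg.comp (measurable_id.prodMk ((hφ.min measurable_const).sub measurable_const))

theorem abs_fromTop_le {g : ℕ → ℝ} {C : ℝ} (hC : ∀ l, |g l| ≤ C) (p k i : ℕ) :
    |fromTop g p k i| ≤ C := by
  unfold fromTop
  split_ifs <;> exact hC _

theorem exists_truncated_correlation_bound [IsProbabilityMeasure μ] (hF : MeasurePreserving F μ μ)
    (hφ : Measurable φ) (h1 : ∀ y, 1 ≤ φ y) (hφi : Integrable (fun y => (φ y : ℝ)) μ)
    (hgood : IsGood F φ μ ι R) {ε : ℝ} (hε : 0 < ε)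
    (hs : Summable fun j : ℕ => (j : ℝ) ^ (1 + ε) * ‖R j‖)
    {f g : Y × ℕ → ℝ} (hf : Measurable f) (hg : Measurable g) {C Cx : ℝ}
    (hfC : ∀ p, |f p| ≤ C) (hgC : ∀ p, |g p| ≤ C)
    (hex : ∀ u : Y → ℝ, (∀ n, 1 ≤ n → ∃ j < n, ∀ y, φ y = n → u y = g (y, j)) →
      ∃ b : B, ι b =ᵐ[μ] (fun y => (u y : ℂ)) ∧ ‖b‖ ≤ Cx) :
    ∃ D : ℝ, 0 ≤ D ∧ ∀ᶠ k in atTop, ∀ n, k ≤ n →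
      |(∫ y, ∑ l ∈ Finset.range (min (φ y) k),
          g (y, l) * f (towerOrbit F (fun y => min (φ y) k) (n + l) y) ∂μ) *
          (∫ y, ((min (φ y) k : ℕ) : ℝ) ∂μ) -
        (∫ y, ∑ l ∈ Finset.range (min (φ y) k), f (y, l) ∂μ) *
          ∫ y, ∑ l ∈ Finset.range (min (φ y) k), g (y, l) ∂μ| ≤
      (∫ y, ((min (φ y) k : ℕ) : ℝ) ∂μ) * (D * (k : ℝ) ^ 2 * radius ε k ^ k /
        (radius (ε / 2) k - 1) * (radius (ε / 2) k)⁻¹ ^ (n - k)) := by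
  have := hgood.space.complete
  have hι := hgood.space.norm_le
  have hren := hgood.renewal
  obtain ⟨y0⟩ : Nonempty Y := μ.nonempty_of_neZero
  have hC0 : 0 ≤ C := (abs_nonneg _).trans (hfC (y0, 0))
  obtain ⟨m, hm1, -⟩ := exists_pairing (μ := μ) hι (g := fun _ => 1) measurable_const zero_le_one
    (by simp)
  have hm : ∀ b, m b = ∫ y, ι b y ∂μ := by simpa using hm1
  obtain ⟨e, he⟩ := hgood.space.const_mem 1
  have h0 := renewalOperators_zero hgood.space.injective hren hF h1
  have hs1 : Summable fun j : ℕ => (j : ℝ) * ‖R j‖ := by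
    refine Summable.of_nonneg_of_le (fun j => by positivity) (fun j => ?_) hs
    rcases Nat.eq_zero_or_pos j with rfl | hj
    · simp [h0]
    · gcongr
      have hj1 : (1 : ℝ) ≤ j := by exact_mod_cast hj
      simpa using Real.rpow_le_rpow_of_exponent_le hj1 (by linarith : (1 : ℝ) ≤ 1 + ε)
  have hsd := spectralData_of_isGood hF hφ h1 hφi hgood hs1 hm he
  have hR : Summable fun j => 1 * ‖R j‖ :=
    hsd.summable_of_le (C := 1) (fun _ => zero_le_one) fun j hj => by
      rw [one_mul]; exact_mod_cast hj
  have hR' : Summable fun j => ‖R j‖ := by simpa using hR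
  obtain ⟨K, hK0, hK⟩ := hsd.exists_bound_inverse_truncated hε hs
  set S := ∑' j, 1 * ‖R j‖ with hS
  have hS0 : 0 ≤ S := tsum_nonneg fun j => by positivity
  have hCx : 0 ≤ Cx := by
    obtain ⟨b, -, hb⟩ := hex (fun y => g (y, 0)) fun n hn => ⟨0, hn, fun y _ => rfl⟩
    exact (norm_nonneg _).trans hb
  refine ⟨2 * (C * ((3 + 4 * (‖m‖ * ‖e‖)) * (K * (S * Cx)))), by positivity, ?_⟩
  filter_upwards [hK, eventually_ge_atTop 2,
    (tendsto_radius ε).eventually_le_const (u := 2) (by norm_num)] with k hKk hk2 hr2 n hkn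
  have hk1 : 1 ≤ k := by omega
  have hkR : (1 : ℝ) < k := by exact_mod_cast hk2
  have hρ1 : 1 < radius (ε / 2) k := Real.one_lt_rpow hkR (by positivity)
  have hρr : radius (ε / 2) k < radius ε k := by
    refine Real.rpow_lt_rpow_of_exponent_lt hkR ?_
    have : (0 : ℝ) < k := by linarith
    gcongr
    linarith
  set ψ : Y → ℕ := fun y => min (φ y) k with hψdef
  have hψ : ∀ y, 1 ≤ ψ y := fun y => le_min (h1 y) hk1
  have hψm : Measurable ψ := hφ.min measurable_const
  have hαm : ∀ t, Measurable fun y => f (towerOrbit F ψ t y) := fun t =>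
    hf.comp (measurable_towerOrbit hF.measurable hψm t)
  have hpair : ∀ u : ℕ → Y → ℝ, (∀ t, Measurable (u t)) → (∀ t y, |u t y| ≤ C) →
      ∃ a : ℕ → B →L[ℂ] ℂ, (∀ t b, a t b = ∫ y, (u t y : ℂ) * ι b y ∂μ) ∧ ∀ t, ‖a t‖ ≤ C := by
    intro u hu hub
    have := fun t => exists_pairing (μ := μ) hι (g := fun y => (u t y : ℂ))
      (Complex.measurable_ofReal.comp (hu t)) hC0 (fun y => by simpa using hub t y)
    choose a ha hb using this
    exact ⟨a, ha, hb⟩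
  obtain ⟨a, ha, hab⟩ := hpair _ hαm fun t y => hfC _
  have hWm : ∀ l, Measurable fun y => if l < min (φ y) k then f (y, l) else 0 := fun l =>
    Measurable.ite (measurableSet_lt measurable_const hψm)
      (hf.comp (measurable_id.prodMk measurable_const)) measurable_const
  have hWC : ∀ l y, |if l < min (φ y) k then f (y, l) else 0| ≤ C := fun l y => by
    split_ifs
    · exact hfC _
    · simpa using hC0
  obtain ⟨W, hW, hWb⟩ := hpair _ hWm hWC
  have hlim := hsd.renewal_limit hρ1 hρr hr2 hC0 hKk hab hWb
    (fun z hz b => renewal_equation hι hren hF hφ h1 hR' hk1 hf hfC ha hW hz b)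
  have hu : ∀ i, ∃ b : B, ι b =ᵐ[μ] (fun y => (fromTop (fun l => g (y, l)) (φ y) k i : ℂ)) ∧
      ‖b‖ ≤ Cx := fun i => hex _ fun n hn => by
    by_cases hin : i + 1 ≤ n
    · exact ⟨min n k - (i + 1), by omega, fun y hy => by simp [fromTop, hy, hin]⟩
    · exact ⟨0, hn, fun y hy => by simp [fromTop, hy, hin]⟩
  choose b hb hbC using hu
  set V : ℕ → B := fun i => wsum R (fun j => if i + 1 ≤ j then 1 else 0) (b i) with hV
  have hind : ∀ i j : ℕ, ‖(if i + 1 ≤ j then 1 else 0 : ℂ)‖ ≤ 1 := fun i j => by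
    split_ifs <;> simp
  have hVn : ∀ i, ‖V i‖ ≤ S * Cx := fun i =>
    ((wsum R _).le_of_opNorm_le (norm_wsum_le hR (hind i)) _).trans (by gcongr; exact hbC i)
  have hVdual : ∀ (i : ℕ) (G : Y → ℝ), Measurable G → (∀ y, |G y| ≤ max C 1) →
      ∫ y, (G y : ℂ) * ι (V i) y ∂μ = ((∫ y, G (F y) * ((if i + 1 ≤ φ y then 1 else 0) *
        fromTop (fun l => g (y, l)) (φ y) k i) ∂μ : ℝ) : ℂ) := by
    intro i G hG hGC
    have hmi : Measurable fun y => (if i + 1 ≤ φ y then 1 else 0 : ℂ) :=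
      Measurable.ite (measurableSet_le measurable_const hφ) measurable_const measurable_const
    rw [integral_mul_wsum hι hren hF hφ (g := fun y => (G y : ℂ))
      (Complex.measurable_ofReal.comp hG) (C := max C 1) (fun y => by simpa using hGC y) hR
      (hind i) (integrable_mul_of_bounded (L1.integrable_coeFn _) hmi fun y => hind i (φ y)),
      ← integral_complex_ofReal]
    refine integral_congr_ae ?_
    filter_upwards [hb i] with y hy
    rw [hy]
    split_ifs <;> simp
  have hVint : ∀ (i : ℕ) (G : Y → ℝ), Measurable G → (∀ y, |G y| ≤ max C 1) →
      Integrable (fun y => G (F y) * ((if i + 1 ≤ φ y then 1 else 0) *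
        fromTop (fun l => g (y, l)) (φ y) k i)) μ := by
    intro i G hG hGC
    refine Integrable.of_bound (C := max C 1 * C) (Measurable.aestronglyMeasurable ?_)
      (ae_of_all _ fun y => ?_)
    · exact (hG.comp hF.measurable).mul ((Measurable.ite (measurableSet_le measurable_const hφ)
        measurable_const measurable_const).mul (measurable_fromTop hφ hg k i))
    · rw [Real.norm_eq_abs, abs_mul]
      refine mul_le_mul (hGC _) ?_ (abs_nonneg _) (by positivity)
      rw [abs_mul]
      have h2 := abs_fromTop_le (fun l => hgC (y, l)) (φ y) k i
      split_ifs
      · simpa using h2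
      · simpa using hC0
  have hsumV : ∀ G : ℕ → Y → ℝ, (∀ i, Measurable (G i)) → (∀ i y, |G i y| ≤ max C 1) →
      ∑ i ∈ Finset.range k, ∫ y, (G i y : ℂ) * ι (V i) y ∂μ =
        ((∫ y, ∑ l ∈ Finset.range (min (φ y) k), g (y, l) * G (min (φ y) k - 1 - l) (F y) ∂μ : ℝ)
          : ℂ) := by
    intro G hG hGC
    simp only [hVdual _ _ (hG _) (hGC _)]
    rw [← Complex.ofReal_sum, ← integral_finsetSum _ fun i _ => hVint i _ (hG i) (hGC i)]
    congr 2
    ext y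
    exact sum_fromTop (fun l => g (y, l)) (fun i => G i (F y)) (φ y) k
  have e1 : ∑ i ∈ Finset.range k, a (n - 1 - i) (V i) =
      ((∫ y, ∑ l ∈ Finset.range (min (φ y) k), g (y, l) * f (towerOrbit F ψ (n + l) y) ∂μ : ℝ)
        : ℂ) := by
    simp only [ha]
    rw [hsumV (fun i y => f (towerOrbit F ψ (n - 1 - i) y)) (fun i => hαm _)
      fun i y => (hfC _).trans (le_max_left _ _)]
    congr 2
    ext y
    refine Finset.sum_congr rfl fun l hl => ?_
    have hl' := Finset.mem_range.1 hl
    have h2 : min (φ y) k ≤ k := min_le_right _ _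
    have h3 : n + l = ψ y + (n - 1 - (min (φ y) k - 1 - l)) := by
      simp only [hψdef]; omega
    rw [h3, towerOrbit_add hψ]
  have e2 : ∑ i ∈ Finset.range k, m (V i) =
      ((∫ y, ∑ l ∈ Finset.range (min (φ y) k), g (y, l) ∂μ : ℝ) : ℂ) := by
    have h2 := hsumV (fun _ _ => 1) (fun _ => measurable_const) (by simp)
    simpa [hm] using h2
  have e3 : m (wsum R (fun j => ((min j k : ℕ) : ℂ)) e) =
      ((∫ y, ((min (φ y) k : ℕ) : ℝ) ∂μ : ℝ) : ℂ) := by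
    have hmk : ∀ j, ‖((min j k : ℕ) : ℂ)‖ ≤ k := fun j => by
      rw [Complex.norm_natCast]; exact_mod_cast min_le_right _ _
    have hmm : Measurable fun y => ((min (φ y) k : ℕ) : ℂ) :=
      (measurable_from_nat (f := fun n : ℕ => (n : ℂ))).comp hψm
    have h2 := integral_mul_wsum hι hren hF hφ (g := fun _ => 1) measurable_const (C := 1)
      (by simp) (c := fun j => ((min j k : ℕ) : ℂ)) (hR'.mul_left (k : ℝ)) hmk (b := e)
      (integrable_mul_of_bounded (L1.integrable_coeFn _) hmm fun y => hmk _)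
    simp only [one_mul] at h2
    rw [hm, h2, ← integral_complex_ofReal]
    refine integral_congr_ae ?_
    filter_upwards [he] with y hy
    rw [hy, mul_one, Complex.ofReal_natCast]
  have e4 : ∑ l ∈ Finset.range k, W l e =
      ((∫ y, ∑ l ∈ Finset.range (min (φ y) k), f (y, l) ∂μ : ℝ) : ℂ) := by
    have h2 : ∀ l, W l e = ((∫ y, (if l < min (φ y) k then f (y, l) else 0) ∂μ : ℝ) : ℂ) := by
      intro l
      rw [hW, ← integral_complex_ofReal]
      refine integral_congr_ae ?_
      filter_upwards [he] with y hy
      rw [hy, mul_one]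
    simp only [h2]
    rw [← Complex.ofReal_sum, ← integral_finsetSum]
    · congr 2
      ext y
      rw [sum_range_eq_sum_ite (min_le_right (φ y) k)]
    · exact fun l _ => Integrable.of_bound (C := C) (hWm l).aestronglyMeasurable
        (ae_of_all _ fun y => hWC l y)
  rw [e3, e4] at hlim
  set Φ := ∫ y, ((min (φ y) k : ℕ) : ℝ) ∂μ with hΦ
  have hΦ0 : 0 ≤ Φ := integral_nonneg fun y => by positivity
  rw [← Real.norm_eq_abs, ← Complex.norm_real, Complex.ofReal_sub, Complex.ofReal_mul,
    Complex.ofReal_mul, ← e1, ← e2, Finset.sum_mul, Finset.mul_sum, ← Finset.sum_sub_distrib]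
  set ρ := radius (ε / 2) k
  set r := radius ε k
  have hr0 : 0 < r := by linarith
  have hρ0 : 0 < ρ - 1 := by linarith
  have hterm : ∀ i ∈ Finset.range k, ‖a (n - 1 - i) (V i) * (Φ : ℂ) -
      ((∫ y, ∑ l ∈ Finset.range (min (φ y) k), f (y, l) ∂μ : ℝ) : ℂ) * m (V i)‖ ≤
      Φ * (2 * (k * r ^ k * (C * ((3 + 4 * (‖m‖ * ‖e‖)) * (K * (S * Cx))))) / (ρ - 1) *
        ρ⁻¹ ^ (n - k)) := by
    intro i hi
    have hik := Finset.mem_range.1 hi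
    refine (hlim (V i) (n - 1 - i)).trans ?_
    rw [Complex.norm_real, Real.norm_of_nonneg hΦ0]
    have h3 : ρ⁻¹ ^ (n - 1 - i) ≤ ρ⁻¹ ^ (n - k) :=
      pow_le_pow_of_le_one (by positivity) (inv_le_one_of_one_le₀ hρ1.le) (by omega)
    have h4 := hVn i
    gcongr
  refine (norm_sum_le _ _).trans ((Finset.sum_le_card_nsmul _ _ _ hterm).trans (le_of_eq ?_))
  rw [Finset.card_range, nsmul_eq_mul]
  ring

end TruncatedCorrelation

section Comparison

variable {Y : Type*} {F : Y → Y} {φ : Y → ℕ}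

/-- The base points whose truncated tower orbit meets a column of height larger than `k` up to time
`t`. -/
def longColumn (F : Y → Y) (φ : Y → ℕ) (k t : ℕ) : Set Y :=
  {y | ∃ s ≤ t, k < φ (towerOrbit F (fun y => min (φ y) k) s y).1}

theorem measurableSet_longColumn [MeasurableSpace Y] (hF : Measurable F) (hφ : Measurable φ)
    (k t : ℕ) : MeasurableSet (longColumn F φ k t) := by
  have h1 : longColumn F φ k t = ⋃ s ∈ Finset.range (t + 1),
      {y | k < φ (towerOrbit F (fun y => min (φ y) k) s y).1} := by
    ext y
    simp [longColumn]
  rw [h1]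
  refine Finset.measurableSet_biUnion _ fun s _ => measurableSet_lt measurable_const ?_
  exact hφ.comp (measurable_fst.comp
    (measurable_towerOrbit hF (hφ.min measurable_const) s))

theorem lt_of_mem_longColumn {k l : ℕ} {y : Y} (hl : l < min (φ y) k)
    (hy : y ∈ longColumn F φ k l) : k < φ y := by
  obtain ⟨s, hs, h⟩ := hy
  rwa [towerOrbit_of_lt (F := F) (ψ := fun y => min (φ y) k) (show s < min (φ y) k by omega)] at h

theorem mem_longColumn_add {k n : ℕ} (hk : 1 ≤ k) (h1 : ∀ y, 1 ≤ φ y) {y : Y}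
    (hy : y ∈ longColumn F φ k (n + min (φ y) k)) : k < φ y ∨ F y ∈ longColumn F φ k n := by
  obtain ⟨s, hs, h⟩ := hy
  by_cases hsl : s < min (φ y) k
  · rw [towerOrbit_of_lt (F := F) (ψ := fun y => min (φ y) k) hsl] at h
    exact Or.inl h
  · right
    obtain ⟨r, rfl⟩ : ∃ r, s = min (φ y) k + r := ⟨s - min (φ y) k, by omega⟩
    rw [towerOrbit_add (F := F) (ψ := fun y => min (φ y) k) (fun y => le_min (h1 y) hk)] at h
    exact ⟨r, by omega, h⟩

theorem towerProj_towerOrbit {X : Type*} [MeasurableSpace X] {T : X → X} {Y : Set X} {F : Y → Y}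
    {φ : Y → ℕ} (hT : ∀ y, (F y : X) = T^[φ y] (y : X)) (h1 : ∀ y, 1 ≤ φ y) {k t : ℕ} (hk : 1 ≤ k)
    {y : Y} (hy : y ∉ longColumn F φ k t) :
    towerProj T (towerOrbit F (fun y => min (φ y) k) t y) = T^[t] (y : X) := by
  induction t with
  | zero => rfl
  | succ t ih =>
    have hyt : y ∉ longColumn F φ k t := fun ⟨s, hs, h⟩ => hy ⟨s, by omega, h⟩
    have hle : φ (towerOrbit F (fun y => min (φ y) k) t y).1 ≤ k := by
      by_contra h
      exact hy ⟨t, by omega, by omega⟩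
    have hlt := towerOrbit_snd_lt (F := F) (ψ := fun y => min (φ y) k)
      (fun y => le_min (h1 y) hk) t y
    rw [Function.iterate_succ_apply', ← ih hyt, towerOrbit_succ]
    set p := towerOrbit F (fun y => min (φ y) k) t y
    rw [towerMap]
    split_ifs with h
    · exact Function.iterate_succ_apply' _ _ _
    · have h2 : p.2 + 1 = φ p.1 := by omega
      simp only [towerProj, Function.iterate_zero, id]
      rw [hT, ← h2, Function.iterate_succ_apply']

variable [MeasurableSpace Y] {μ : Measure Y}

theorem integral_longColumn_le [IsProbabilityMeasure μ]
    (hF : MeasurePreserving F μ μ) (hφ : Measurable φ)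
    (h1 : ∀ y, 1 ≤ φ y) {k : ℕ} (hk : 1 ≤ k) (n : ℕ) :
    ∫ y, ∑ l ∈ Finset.range (min (φ y) k), (longColumn F φ k (n + l)).indicator (1 : Y → ℝ) y ∂μ ≤
      (n + k) * μ.real {y | k < φ y} := by
  have hψm : Measurable fun y => min (φ y) k := hφ.min measurable_const
  have hm := fun t => measurableSet_longColumn hF.measurable hφ k t
  have hAm : MeasurableSet {y | k < φ y} := measurableSet_lt measurable_const hφ
  have hind : ∀ (A : Set Y) y, |A.indicator (1 : Y → ℝ) y| ≤ 1 := fun A y => by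
    by_cases hy : y ∈ A <;> simp [hy]
  have hind0 : ∀ (A : Set Y) y, 0 ≤ A.indicator (1 : Y → ℝ) y := fun A y =>
    Set.indicator_nonneg (fun _ _ => zero_le_one) y
  have hii : ∀ A : Set Y, MeasurableSet A → Integrable (A.indicator (1 : Y → ℝ)) μ := fun A hA =>
    (integrable_const (1 : ℝ)).indicator hA
  have hψi : Integrable (fun y => ((min (φ y) k : ℕ) : ℝ)) μ :=
    Integrable.of_bound (C := (k : ℝ)) (measurable_from_nat.comp hψm).aestronglyMeasurable
      (ae_of_all _ fun y => by
        rw [Real.norm_of_nonneg (by positivity)]; exact_mod_cast min_le_right _ _)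
  have hsi : ∀ n, Integrable (fun y => ∑ l ∈ Finset.range (min (φ y) k),
      (longColumn F φ k (n + l)).indicator (1 : Y → ℝ) y) μ := fun n =>
    integrable_column_sum hψm hψi (fun l => measurable_const.indicator (hm (n + l)))
      fun l y => hind _ y
  induction n with
  | zero =>
    have h2 : ∀ y, ∑ l ∈ Finset.range (min (φ y) k),
        (longColumn F φ k (0 + l)).indicator (1 : Y → ℝ) y ≤
          k * {y | k < φ y}.indicator (1 : Y → ℝ) y := by
      intro y
      have h3 : ∀ l ∈ Finset.range (min (φ y) k),
          (longColumn F φ k (0 + l)).indicator (1 : Y → ℝ) y ≤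
            {y | k < φ y}.indicator (1 : Y → ℝ) y := by
        intro l hl
        rw [zero_add]
        by_cases hy : y ∈ longColumn F φ k l
        · have h4 : y ∈ {y | k < φ y} := lt_of_mem_longColumn (Finset.mem_range.1 hl) hy
          simp [hy, h4]
        · rw [Set.indicator_of_notMem hy]
          exact hind0 _ _
      refine (Finset.sum_le_card_nsmul _ _ _ h3).trans ?_
      rw [Finset.card_range, nsmul_eq_mul]
      refine mul_le_mul_of_nonneg_right ?_ (hind0 _ _)
      exact_mod_cast min_le_right _ _
    refine (integral_mono (hsi 0) ((hii _ hAm).const_mul _) h2).trans ?_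
    rw [integral_const_mul, integral_indicator_one hAm]
    simp
  | succ n ih =>
    have h2 : ∀ y, ∑ l ∈ Finset.range (min (φ y) k),
        (longColumn F φ k (n + 1 + l)).indicator (1 : Y → ℝ) y +
          (longColumn F φ k n).indicator (1 : Y → ℝ) y ≤
        ∑ l ∈ Finset.range (min (φ y) k), (longColumn F φ k (n + l)).indicator (1 : Y → ℝ) y +
          ({y | k < φ y}.indicator (1 : Y → ℝ) y +
            (longColumn F φ k n).indicator (1 : Y → ℝ) (F y)) := by
      intro y
      have h3 := Finset.sum_range_succ
        (fun l => (longColumn F φ k (n + l)).indicator (1 : Y → ℝ) y) (min (φ y) k)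
      have h4 := Finset.sum_range_succ'
        (fun l => (longColumn F φ k (n + l)).indicator (1 : Y → ℝ) y) (min (φ y) k)
      have h5 : (longColumn F φ k (n + min (φ y) k)).indicator (1 : Y → ℝ) y ≤
          {y | k < φ y}.indicator (1 : Y → ℝ) y +
            (longColumn F φ k n).indicator (1 : Y → ℝ) (F y) := by
        by_cases hy : y ∈ longColumn F φ k (n + min (φ y) k)
        · rw [Set.indicator_of_mem hy]
          rcases mem_longColumn_add hk h1 hy with h | h
          · have h6 : y ∈ {y | k < φ y} := h
            rw [Set.indicator_of_mem h6]
            exact le_add_of_nonneg_right (hind0 _ _)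
          · rw [Set.indicator_of_mem h]
            exact le_add_of_nonneg_left (hind0 _ _)
        · rw [Set.indicator_of_notMem hy]
          exact add_nonneg (hind0 _ _) (hind0 _ _)
      have h6 : ∀ l, n + 1 + l = n + (l + 1) := fun l => by omega
      simp only [h6]
      rw [add_zero] at h4
      linarith
    have hcomp : Integrable (fun y => (longColumn F φ k n).indicator (1 : Y → ℝ) (F y)) μ :=
      hF.integrable_comp_of_integrable (hii _ (hm n))
    have hinv : ∫ y, (longColumn F φ k n).indicator (1 : Y → ℝ) (F y) ∂μ =
        ∫ y, (longColumn F φ k n).indicator (1 : Y → ℝ) y ∂μ := by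
      have := integral_map (μ := μ) (f := (longColumn F φ k n).indicator (1 : Y → ℝ))
        hF.measurable.aemeasurable (measurable_const.indicator (hm n)).aestronglyMeasurable
      rw [hF.map_eq] at this
      exact this.symm
    have h3 := integral_mono ((hsi (n + 1)).add (hii _ (hm n)))
      ((hsi n).add ((hii _ hAm).add hcomp)) h2
    have e1 := integral_add (hsi (n + 1)) (hii _ (hm n))
    have e2 := integral_add (hsi n) ((hii _ hAm).add hcomp)
    have e3 := integral_add (hii _ hAm) hcomp
    have e4 := integral_indicator_one (μ := μ) hAm
    simp only [Pi.add_apply] at h3 e1 e2 e3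
    push_cast
    linarith

theorem integral_column_sum_sub_le (hφ : Measurable φ) (hφi : Integrable (fun y => (φ y : ℝ)) μ)
    (k : ℕ) {h h' : ℕ → Y → ℝ} {C : ℝ} (hm : ∀ l, Measurable (h l)) (hm' : ∀ l, Measurable (h' l))
    (hC : ∀ l y, |h l y| ≤ C) (hC' : ∀ l y, |h' l y| ≤ C) :
    |(∫ y, ∑ l ∈ Finset.range (φ y), h l y ∂μ) -
        ∫ y, ∑ l ∈ Finset.range (min (φ y) k), h' l y ∂μ| ≤
      C * (∫ y in {y | k < φ y}, (φ y : ℝ) ∂μ) +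
        ∫ y, ∑ l ∈ Finset.range (min (φ y) k), |h l y - h' l y| ∂μ := by
  have hψm : Measurable fun y => min (φ y) k := hφ.min measurable_const
  have hψi : Integrable (fun y => ((min (φ y) k : ℕ) : ℝ)) μ :=
    hφi.mono' (measurable_from_nat.comp hψm).aestronglyMeasurable (ae_of_all _ fun y => by
      rw [Real.norm_of_nonneg (by positivity)]; exact_mod_cast min_le_left _ _)
  have hAm : MeasurableSet {y | k < φ y} := measurableSet_lt measurable_const hφ
  have hi1 := integrable_column_sum hφ hφi hm hC
  have hi2 := integrable_column_sum hψm hψi hm' hC'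
  have hi3 : Integrable (fun y => ∑ l ∈ Finset.range (min (φ y) k), |h l y - h' l y|) μ :=
    integrable_column_sum (C := C + C) hψm hψi
      (fun l => ((hm l).sub (hm' l)).abs) fun l y => by
        rw [abs_abs]
        exact (abs_sub _ _).trans (add_le_add (hC l y) (hC' l y))
  rw [← integral_sub hi1 hi2, ← integral_indicator hAm, ← integral_const_mul,
    ← integral_add ((hφi.indicator hAm).const_mul C) hi3]
  refine (abs_integral_le_integral_abs).trans (integral_mono (hi1.sub hi2).abs
    (((hφi.indicator hAm).const_mul C).add hi3) fun y => ?_)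
  have e1 := Finset.sum_range_add_sum_Ico (fun l => h l y) (min_le_left (φ y) k)
  have h2 : |∑ l ∈ Finset.Ico (min (φ y) k) (φ y), h l y| ≤
      C * {y | k < φ y}.indicator (fun y => (φ y : ℝ)) y := by
    by_cases hy : k < φ y
    · rw [Set.indicator_of_mem (show y ∈ {y | k < φ y} from hy)]
      refine (Finset.abs_sum_le_sum_abs _ _).trans
        ((Finset.sum_le_card_nsmul _ _ C fun l _ => hC l y).trans ?_)
      rw [nsmul_eq_mul, Nat.card_Ico, mul_comm]
      have hC0 : 0 ≤ C := (abs_nonneg _).trans (hC 0 y)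
      gcongr
      omega
    · rw [min_eq_left (by omega), Finset.Ico_self,
        Set.indicator_of_notMem (show y ∉ {y | k < φ y} from hy)]
      simp
  have h3 : |∑ l ∈ Finset.range (min (φ y) k), (h l y - h' l y)| ≤
      ∑ l ∈ Finset.range (min (φ y) k), |h l y - h' l y| := Finset.abs_sum_le_sum_abs _ _
  rw [Finset.sum_sub_distrib] at h3
  simp only
  rw [← e1]
  calc _ = |(∑ l ∈ Finset.Ico (min (φ y) k) (φ y), h l y) +
        (∑ l ∈ Finset.range (min (φ y) k), h l y -
          ∑ l ∈ Finset.range (min (φ y) k), h' l y)| := by congr 1; ring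
    _ ≤ _ := (abs_add_le _ _).trans (add_le_add h2 h3)

end Comparison

section Asymptotics

theorem exists_sum_rpow_le {q : ℝ} (hq : 0 < q) :
    ∃ C : ℝ, 0 ≤ C ∧ ∀ N : ℕ,
      ∑ n ∈ Finset.range N, ((n + 1 : ℕ) : ℝ) ^ (q - 1) ≤ C * (N : ℝ) ^ q := by
  rcases le_total 1 q with h | h
  · refine ⟨1, zero_le_one, fun N => ?_⟩
    rcases Nat.eq_zero_or_pos N with rfl | hN
    · simp [Real.zero_rpow hq.ne']
    have hN0 : (0 : ℝ) < N := by exact_mod_cast hN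
    refine (Finset.sum_le_card_nsmul _ _ ((N : ℝ) ^ (q - 1)) fun n hn => ?_).trans ?_
    · have : ((n + 1 : ℕ) : ℝ) ≤ N := by exact_mod_cast Finset.mem_range.1 hn
      exact Real.rpow_le_rpow (by positivity) this (by linarith)
    · rw [Finset.card_range, nsmul_eq_mul, one_mul, Real.rpow_sub_one hN0.ne']
      field_simp
      exact le_rfl
  · refine ⟨q⁻¹, by positivity, fun N => ?_⟩
    induction N with
    | zero => simp [Real.zero_rpow hq.ne']
    | succ N ih =>
      rw [Finset.sum_range_succ]
      set x : ℝ := ((N + 1 : ℕ) : ℝ) with hx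
      have hxN : (N : ℝ) = x - 1 := by rw [hx]; push_cast; ring
      have hx1 : 1 ≤ x := by rw [hx]; push_cast; linarith [Nat.cast_nonneg (α := ℝ) N]
      have hx0 : 0 < x := by linarith
      have h2 := rpow_one_add_le_one_add_mul_self (s := -x⁻¹)
        (by simpa using inv_le_one_of_one_le₀ hx1) hq.le h
      have h3 : (N : ℝ) ^ q = x ^ q * (1 + -x⁻¹) ^ q := by
        rw [← Real.mul_rpow hx0.le (by
          have := inv_le_one_of_one_le₀ hx1
          linarith), hxN]
        congr 1
        field_simp
        ring
      have h4 : (N : ℝ) ^ q ≤ x ^ q - q * x ^ (q - 1) := by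
        rw [h3, Real.rpow_sub_one hx0.ne']
        have h5 := mul_le_mul_of_nonneg_left h2 (Real.rpow_nonneg hx0.le q)
        refine h5.trans (le_of_eq ?_)
        field_simp
        ring
      have h6 : q⁻¹ * (N : ℝ) ^ q ≤ q⁻¹ * (x ^ q - q * x ^ (q - 1)) := by gcongr
      have h7 : q⁻¹ * (x ^ q - q * x ^ (q - 1)) = q⁻¹ * x ^ q - x ^ (q - 1) := by
        field_simp
      linarith

theorem truncation_error_le {ε q : ℝ} (hε : 0 < ε) {p k n : ℕ} (hk : 3 ≤ k)
    (hp : 3 + ε + (q + 1) ≤ ε / 2 * (p - 1 : ℕ)) (hn : p * k ≤ n) :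
    (k : ℝ) ^ 2 * radius ε k ^ k / (radius (ε / 2) k - 1) * (radius (ε / 2) k)⁻¹ ^ (n - k) ≤
      2 / ε * (k : ℝ) ^ (-(q + 1)) := by
  have hk3 : (3 : ℝ) ≤ k := by exact_mod_cast hk
  have hk0 : (0 : ℝ) < k := by linarith
  have hlog : 1 ≤ Real.log k := by
    rw [Real.le_log_iff_exp_le hk0]
    linarith [Real.exp_one_lt_three]
  have hρ : ε / 2 / k ≤ radius (ε / 2) k - 1 := by
    rw [radius, Real.rpow_def_of_pos hk0]
    have h1 := Real.add_one_le_exp (Real.log k * (ε / 2 / k))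
    have h2 : 1 * (ε / 2 / k) ≤ Real.log k * (ε / 2 / k) := by gcongr
    linarith
  have hρ1 : 1 ≤ radius (ε / 2) k := one_le_radius (by positivity) (by omega)
  have h1 : (radius (ε / 2) k)⁻¹ ^ (n - k) ≤ (k : ℝ) ^ (-(ε / 2 * (p - 1 : ℕ))) := by
    have h2 : (radius (ε / 2) k)⁻¹ ^ (n - k) ≤ (radius (ε / 2) k)⁻¹ ^ (k * (p - 1)) := by
      refine pow_le_pow_of_le_one (by positivity) (inv_le_one_of_one_le₀ hρ1) ?_
      rw [Nat.mul_sub, mul_one, mul_comm k p]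
      omega
    refine h2.trans (le_of_eq ?_)
    rw [inv_pow, pow_mul, radius_pow_self (by omega), Real.rpow_neg hk0.le,
      Real.rpow_mul_natCast hk0.le]
  rw [radius_pow_self (by omega)]
  calc (k : ℝ) ^ 2 * (k : ℝ) ^ ε / (radius (ε / 2) k - 1) * (radius (ε / 2) k)⁻¹ ^ (n - k)
      ≤ (k : ℝ) ^ 2 * (k : ℝ) ^ ε / (ε / 2 / k) * (k : ℝ) ^ (-(ε / 2 * (p - 1 : ℕ))) := by
        gcongr
    _ = 2 / ε * ((k : ℝ) ^ (3 : ℝ) * (k : ℝ) ^ ε * (k : ℝ) ^ (-(ε / 2 * (p - 1 : ℕ)))) := by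
        rw [show (3 : ℝ) = ((3 : ℕ) : ℝ) by norm_num, Real.rpow_natCast]
        field_simp
    _ ≤ 2 / ε * (k : ℝ) ^ (-(q + 1)) := by
        rw [← Real.rpow_add hk0, ← Real.rpow_add hk0]
        gcongr
        · linarith
        · linarith

theorem summable_rpow_mul_tail {Y : Type*} [MeasurableSpace Y] {μ : Measure Y} {φ : Y → ℕ}
    (hφ : Measurable φ) (hφi : Integrable (fun y => (φ y : ℝ)) μ) {q : ℝ} (hq : 0 < q)
    (hφq : Integrable (fun y => (φ y : ℝ) ^ (q + 1)) μ) (p : ℕ) :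
    Summable fun n : ℕ => ((n + 1 : ℕ) : ℝ) ^ (q - 1) *
      ∫ y in {y | n + 1 < φ y * p}, (φ y : ℝ) ∂μ := by
  obtain ⟨C, hC0, hC⟩ := exists_sum_rpow_le hq
  have hm : ∀ n, MeasurableSet {y | n + 1 < φ y * p} := fun n =>
    measurableSet_lt measurable_const (hφ.mul_const p)
  refine summable_of_sum_range_le (c := ∫ y, C * (p : ℝ) ^ q * (φ y : ℝ) ^ (q + 1) ∂μ)
    (fun n => mul_nonneg (by positivity) (integral_nonneg fun _ => by positivity)) fun N => ?_
  simp only [← integral_indicator (hm _), ← integral_const_mul]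
  have hi : ∀ n : ℕ, Integrable (fun y => ((n + 1 : ℕ) : ℝ) ^ (q - 1) *
      {y | n + 1 < φ y * p}.indicator (fun y => (φ y : ℝ)) y) μ := fun n =>
    (hφi.indicator (hm n)).const_mul _
  rw [← integral_finsetSum _ fun n _ => hi n]
  refine integral_mono (integrable_finsetSum _ fun n _ => hi n) (hφq.const_mul _) fun y => ?_
  have h1 : ∀ n : ℕ, ((n + 1 : ℕ) : ℝ) ^ (q - 1) *
      {y | n + 1 < φ y * p}.indicator (fun y => (φ y : ℝ)) y =
      φ y * if n + 1 < φ y * p then ((n + 1 : ℕ) : ℝ) ^ (q - 1) else 0 := fun n => by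
    by_cases h : n + 1 < φ y * p
    · rw [if_pos h, Set.indicator_of_mem (show y ∈ {y | n + 1 < φ y * p} from h), mul_comm]
    · rw [if_neg h, Set.indicator_of_notMem (show y ∉ {y | n + 1 < φ y * p} from h)]
      simp
  simp only [h1]
  rw [← Finset.mul_sum, ← Finset.sum_filter]
  have h2 : ∑ n ∈ Finset.range N with n + 1 < φ y * p, ((n + 1 : ℕ) : ℝ) ^ (q - 1) ≤
      C * ((φ y * p : ℕ) : ℝ) ^ q := by
    refine (Finset.sum_le_sum_of_subset_of_nonneg (fun n hn => ?_)
      fun _ _ _ => by positivity).trans (hC _)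
    have := (Finset.mem_filter.1 hn).2
    exact Finset.mem_range.2 (by omega)
  calc (φ y : ℝ) * ∑ n ∈ Finset.range N with n + 1 < φ y * p, ((n + 1 : ℕ) : ℝ) ^ (q - 1)
      ≤ φ y * (C * ((φ y * p : ℕ) : ℝ) ^ q) := by gcongr
    _ = C * (p : ℝ) ^ q * (φ y : ℝ) ^ (q + 1) := by
        rcases Nat.eq_zero_or_pos (φ y) with h0 | h0
        · simp [h0, Real.zero_rpow (by linarith : q + 1 ≠ 0)]
        · rw [Nat.cast_mul, Real.mul_rpow (by positivity) (by positivity),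
            Real.rpow_add_one (by exact_mod_cast h0.ne')]
          ring

end Asymptotics

section Correlation

variable {X : Type*} [MeasurableSpace X] {T : X → X} {Y : Set X} {φ : Y → ℕ} {F : Y → Y}
  {μ : Measure Y} {B : Type*} [NormedAddCommGroup B] [NormedSpace ℂ B]
  {ι : B →ₗ[ℂ] Lp ℂ 1 μ} {R : ℕ → B →L[ℂ] B}

theorem measurable_towerProj (hT : Measurable T) : Measurable (towerProj T (Y := Y)) :=
  measurable_from_prod_countable_left fun l => (hT.iterate l).comp measurable_subtype_coe

theorem abs_mul_sub_le {t t' Φ Φ' V V' W W' J M C E : ℝ} (hC : 0 ≤ C) (hΦ : 0 ≤ Φ) (hJ : 0 ≤ J)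
    (h1 : |t - t'| ≤ C ^ 2 * J + 2 * C ^ 2 * M) (h2 : |Φ - Φ'| ≤ J) (h3 : |V - V'| ≤ C * J)
    (h4 : |W - W'| ≤ C * J) (h5 : |t'| ≤ C ^ 2 * Φ) (h6 : |W'| ≤ C * Φ) (h7 : |V| ≤ C * Φ)
    (h8 : |t' * Φ' - W' * V'| ≤ E) :
    |t * Φ - W * V| ≤ C ^ 2 * Φ * (4 * J + 2 * M) + E := by
  have e : t * Φ - W * V =
      (t - t') * Φ + t' * (Φ - Φ') - (W - W') * V - W' * (V - V') + (t' * Φ' - W' * V') := by ring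
  have a1 : |(t - t') * Φ| ≤ (C ^ 2 * J + 2 * C ^ 2 * M) * Φ := by
    rw [abs_mul, abs_of_nonneg hΦ]; gcongr
  have a2 : |t' * (Φ - Φ')| ≤ C ^ 2 * Φ * J := by rw [abs_mul]; gcongr
  have a3 : |(W - W') * V| ≤ C * J * (C * Φ) := by rw [abs_mul]; gcongr
  have a4 : |W' * (V - V')| ≤ C * Φ * (C * J) := by rw [abs_mul]; gcongr
  rw [abs_le] at *
  rw [e]
  constructor <;> nlinarith

theorem exists_correlation_bound (hS : IsInducingScheme T Y φ F μ) (hgood : IsGood F φ μ ι R)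
    {ε : ℝ} (hε : 0 < ε) (hs : Summable fun j : ℕ => (j : ℝ) ^ (1 + ε) * ‖R j‖) {q : ℝ} (hq : 0 < q)
    {v w : X → ℝ} (hv : Measurable v) (hw : Measurable w) {C : ℝ}
    (hvC : ∀ x, |v x| ≤ C) (hwC : ∀ x, |w x| ≤ C) (hex : Exchangeable T φ ι v) :
    ∃ (A : ℝ) (p : ℕ), ∀ᶠ n : ℕ in atTop,
      |(∫ y, ∑ l ∈ Finset.range (φ y), v (T^[l] (y : X)) * w (T^[n] (T^[l] (y : X))) ∂μ) *
          (∫ y, (φ y : ℝ) ∂μ) -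
        (∫ y, ∑ l ∈ Finset.range (φ y), w (T^[l] (y : X)) ∂μ) *
          ∫ y, ∑ l ∈ Finset.range (φ y), v (T^[l] (y : X)) ∂μ| ≤
      A * ((∫ y in {y | n < φ y * p}, (φ y : ℝ) ∂μ) + (n : ℝ) ^ (-(q + 1))) := by
  have hprob := hS.prob
  have hF := hS.ergodic.toMeasurePreserving
  have hφ := hS.measurable_return
  have h1 := hS.return_pos
  have hφi := hS.integrable_return
  have hπ := measurable_towerProj (Y := Y) hS.measurable_map
  obtain ⟨y0⟩ : Nonempty Y := μ.nonempty_of_neZero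
  have hC0 : 0 ≤ C := (abs_nonneg _).trans (hvC y0)
  obtain ⟨Cx, hCx⟩ := hex
  obtain ⟨D, hD0, hD⟩ := exists_truncated_correlation_bound hF hφ h1 hφi hgood hε hs
    (f := fun p => w (towerProj T p)) (g := fun p => v (towerProj T p)) (hw.comp hπ) (hv.comp hπ)
    (fun _ => hwC _) (fun _ => hvC _) (Cx := Cx) fun u hu => hCx u fun n hn => by
      obtain ⟨j, hj, h⟩ := hu n hn
      exact ⟨j, hj, h⟩
  obtain ⟨p0, hp0⟩ := exists_nat_ge ((3 + ε + (q + 1)) / (ε / 2))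
  have hp : 3 + ε + (q + 1) ≤ ε / 2 * ((p0 + 1 - 1 : ℕ) : ℝ) := by
    rw [div_le_iff₀ (by positivity)] at hp0
    simpa [mul_comm] using hp0
  set p := p0 + 1
  set Φ := ∫ y, (φ y : ℝ) ∂μ with hΦ
  have hΦ0 : 0 ≤ Φ := integral_nonneg fun y => by positivity
  refine ⟨C ^ 2 * Φ * (4 + 2 * (p + 1)) + Φ * D * (2 / ε) * (2 * p) ^ (q + 1), p, ?_⟩
  have hdiv : Tendsto (fun n => n / p) atTop atTop := Nat.tendsto_div_const_atTop (by omega)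
  filter_upwards [hdiv.eventually hD, hdiv.eventually (eventually_ge_atTop 3),
    eventually_ge_atTop 1] with n hn hk3 hn1
  set k := n / p with hk
  have hkn : k ≤ n := Nat.div_le_self _ _
  have hpk : p * k ≤ n := Nat.mul_div_le n p
  have hnk : n < p * (k + 1) := Nat.lt_mul_div_succ n (by omega)
  have hk1 : 1 ≤ k := by omega
  have hset : {y | n < φ y * p} = {y | k < φ y} := by
    ext y
    exact (Nat.div_lt_iff_lt_mul (by omega)).symm
  rw [hset]
  have hAm : MeasurableSet {y | k < φ y} := measurableSet_lt measurable_const hφ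
  set J := ∫ y in {y | k < φ y}, (φ y : ℝ) ∂μ with hJ
  have hJ0 : 0 ≤ J := integral_nonneg fun y => by positivity
  set M := ((n : ℝ) + k) * μ.real {y | k < φ y} with hM
  have hMJ : M ≤ (p + 1) * J := by
    have h2 : μ.real {y | k < φ y} * ((k : ℝ) + 1) ≤ J := by
      rw [hJ, ← smul_eq_mul, ← setIntegral_const]
      refine setIntegral_mono_on (integrable_const _).integrableOn hφi.integrableOn hAm
        fun y hy => ?_
      have hy' : k + 1 ≤ φ y := hy
      exact_mod_cast hy'
    have h3 : (n : ℝ) + k ≤ (p + 1) * (k + 1) := by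
      have h4 : (n : ℝ) ≤ p * (k + 1) := by exact_mod_cast hnk.le
      linarith
    calc M ≤ ((p + 1) * (k + 1)) * μ.real {y | k < φ y} :=
          mul_le_mul_of_nonneg_right h3 measureReal_nonneg
      _ = (p + 1) * (μ.real {y | k < φ y} * ((k : ℝ) + 1)) := by ring
      _ ≤ _ := by gcongr
  have hψm : Measurable fun y => min (φ y) k := hφ.min measurable_const
  have hψi : Integrable (fun y => ((min (φ y) k : ℕ) : ℝ)) μ :=
    hφi.mono' (measurable_from_nat.comp hψm).aestronglyMeasurable (ae_of_all _ fun y => by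
      rw [Real.norm_of_nonneg (by positivity)]; exact_mod_cast min_le_left _ _)
  have hTm : ∀ l, Measurable fun y : Y => T^[l] (y : X) := fun l =>
    (hS.measurable_map.iterate l).comp measurable_subtype_coe
  have hvm : ∀ l, Measurable fun y : Y => v (T^[l] (y : X)) := fun l => hv.comp (hTm l)
  have hwm : ∀ l, Measurable fun y : Y => w (T^[l] (y : X)) := fun l => hw.comp (hTm l)
  have hom : ∀ t, Measurable fun y =>
      w (towerProj T (towerOrbit F (fun y => min (φ y) k) t y)) := fun t =>
    hw.comp (hπ.comp (measurable_towerOrbit hF.measurable hψm t))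
  have hprod : ∀ (a b : X), |v a * w b| ≤ C ^ 2 := fun a b => by
    rw [abs_mul, sq]; exact mul_le_mul (hvC _) (hwC _) (abs_nonneg _) hC0
  have hshift : ∀ (l : ℕ) (y : Y), T^[n] (T^[l] (y : X)) = T^[n + l] (y : X) := fun l y =>
    (Function.iterate_add_apply _ _ _ _).symm
  simp only [hshift]
  have hΦk : |Φ - ∫ y, ((min (φ y) k : ℕ) : ℝ) ∂μ| ≤ J := by
    have := integral_column_sum_sub_le hφ hφi k (h := fun _ _ => 1) (h' := fun _ _ => 1) (C := 1)
      (fun _ => measurable_const) (fun _ => measurable_const) (by simp) (by simp)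
    simpa using this
  have hdiff : ∀ u : X → ℝ, Measurable u → (∀ x, |u x| ≤ C) →
      |(∫ y, ∑ l ∈ Finset.range (φ y), u (T^[l] (y : X)) ∂μ) -
        ∫ y, ∑ l ∈ Finset.range (min (φ y) k), u (T^[l] (y : X)) ∂μ| ≤ C * J := by
    intro u hu huC
    have := integral_column_sum_sub_le hφ hφi k (h := fun l (y : Y) => u (T^[l] (y : X)))
      (h' := fun l (y : Y) => u (T^[l] (y : X))) (C := C) (fun l => hu.comp (hTm l))
      (fun l => hu.comp (hTm l)) (fun _ _ => huC _) (fun _ _ => huC _)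
    simpa using this
  have hbound : ∀ (r : Y → ℕ) (h : ℕ → Y → ℝ) (K : ℝ), 0 ≤ K → (∀ y, r y ≤ φ y) →
      (∀ l y, |h l y| ≤ K) → |∫ y, ∑ l ∈ Finset.range (r y), h l y ∂μ| ≤ K * Φ := by
    intro r h K hK0 hr hK
    rw [← Real.norm_eq_abs, hΦ, ← integral_const_mul]
    refine norm_integral_le_of_norm_le (hφi.const_mul K) (ae_of_all _ fun y => ?_)
    refine (norm_column_sum_le (h := fun l => h l y) fun l => hK l y).trans ?_
    gcongr
    exact hr y
  have hind : ∀ (A : Set Y) y, |A.indicator (1 : Y → ℝ) y| ≤ 1 := fun A y => by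
    by_cases hy : y ∈ A <;> simp [hy]
  have ht : |(∫ y, ∑ l ∈ Finset.range (φ y), v (T^[l] (y : X)) * w (T^[n + l] (y : X)) ∂μ) -
      ∫ y, ∑ l ∈ Finset.range (min (φ y) k), v (T^[l] (y : X)) *
        w (towerProj T (towerOrbit F (fun y => min (φ y) k) (n + l) y)) ∂μ| ≤
      C ^ 2 * J + 2 * C ^ 2 * M := by
    refine (integral_column_sum_sub_le hφ hφi k (C := C ^ 2)
      (h := fun l y => v (T^[l] (y : X)) * w (T^[n + l] (y : X)))
      (h' := fun l y => v (T^[l] (y : X)) *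
        w (towerProj T (towerOrbit F (fun y => min (φ y) k) (n + l) y)))
      (fun l => (hvm l).mul (hwm (n + l))) (fun l => (hvm l).mul (hom (n + l)))
      (fun _ _ => hprod _ _) (fun _ _ => hprod _ _)).trans ?_
    refine add_le_add le_rfl ?_
    refine le_trans ?_ (mul_le_mul_of_nonneg_left (integral_longColumn_le hF hφ h1 hk1 n)
      (by positivity : 0 ≤ 2 * C ^ 2))
    rw [← integral_const_mul]
    refine integral_mono (integrable_column_sum (C := C ^ 2 + C ^ 2) hψm hψi
      (fun l => (((hvm l).mul (hwm (n + l))).sub ((hvm l).mul (hom (n + l)))).abs) fun l y => ?_)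
      ((integrable_column_sum (C := 1) hψm hψi (fun l => measurable_const.indicator
        (measurableSet_longColumn hF.measurable hφ k (n + l))) fun l y => ?_).const_mul _)
      fun y => ?_
    · rw [abs_abs]
      exact (abs_sub _ _).trans (add_le_add (hprod _ _) (hprod _ _))
    · exact hind _ _
    · simp only
      rw [Finset.mul_sum]
      refine Finset.sum_le_sum fun l _ => ?_
      by_cases hy : y ∈ longColumn F φ k (n + l)
      · rw [Set.indicator_of_mem hy]
        refine (abs_sub _ _).trans ((add_le_add (hprod _ _) (hprod _ _)).trans (le_of_eq ?_))
        simp only [Pi.one_apply]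
        ring
      · rw [towerProj_towerOrbit hS.induced_eq h1 hk1 hy, sub_self, abs_zero,
          Set.indicator_of_notMem hy, mul_zero]
  have hmain := abs_mul_sub_le hC0 hΦ0 hJ0 ht hΦk (hdiff v hv hvC) (hdiff w hw hwC)
    (hbound (fun y => min (φ y) k) _ _ (by positivity) (fun y => min_le_left _ _)
      (fun _ _ => hprod _ _))
    (hbound (fun y => min (φ y) k) _ _ hC0 (fun y => min_le_left _ _) (fun _ _ => hwC _))
    (hbound φ _ _ hC0 (fun y => le_rfl) (fun _ _ => hvC _)) (hn n hkn)
  refine hmain.trans ?_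
  have hk0 : (0 : ℝ) < k := by exact_mod_cast hk1
  have hn0 : (0 : ℝ) < n := by exact_mod_cast hn1
  have herr := truncation_error_le (q := q) hε hk3 hp hpk
  have hΦkΦ : ∫ y, ((min (φ y) k : ℕ) : ℝ) ∂μ ≤ Φ :=
    integral_mono hψi hφi fun y => Nat.cast_le.2 (min_le_left (φ y) k)
  have hpow : (k : ℝ) ^ (-(q + 1)) ≤ (2 * p) ^ (q + 1) * (n : ℝ) ^ (-(q + 1)) := by
    have hp0 : (0 : ℝ) < 2 * p := by
      have : 0 < p := Nat.succ_pos _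
      positivity
    have h2 : (n : ℝ) / (2 * p) ≤ k := by
      rw [div_le_iff₀ hp0]
      have h3 : n ≤ k * (2 * p) := by nlinarith
      exact_mod_cast h3
    refine (Real.rpow_le_rpow_of_nonpos (by positivity) h2 (by linarith)).trans (le_of_eq ?_)
    rw [Real.div_rpow hn0.le hp0.le, Real.rpow_neg hp0.le, div_inv_eq_mul, mul_comm]
  have hE : (∫ y, ((min (φ y) k : ℕ) : ℝ) ∂μ) * (D * (k : ℝ) ^ 2 * radius ε k ^ k /
        (radius (ε / 2) k - 1) * (radius (ε / 2) k)⁻¹ ^ (n - k)) ≤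
      Φ * D * (2 / ε) * (2 * p) ^ (q + 1) * (n : ℝ) ^ (-(q + 1)) := by
    calc _ = (∫ y, ((min (φ y) k : ℕ) : ℝ) ∂μ) * (D * ((k : ℝ) ^ 2 * radius ε k ^ k /
        (radius (ε / 2) k - 1) * (radius (ε / 2) k)⁻¹ ^ (n - k))) := by ring
      _ ≤ Φ * (D * (2 / ε * ((2 * p) ^ (q + 1) * (n : ℝ) ^ (-(q + 1))))) := by
        refine mul_le_mul hΦkΦ (mul_le_mul_of_nonneg_left (herr.trans (by gcongr)) hD0) ?_ hΦ0
        have hρ1 := one_le_radius (half_pos hε).le hk1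
        have hρ0 : 0 ≤ radius (ε / 2) k - 1 := by linarith
        have hr0 : 0 ≤ radius ε k := zero_le_one.trans (one_le_radius hε.le hk1)
        positivity
      _ = _ := by ring
  have hx : (0 : ℝ) ≤ (n : ℝ) ^ (-(q + 1)) := by positivity
  have hy1 : 0 ≤ C ^ 2 * Φ * (4 + 2 * (p + 1)) := by positivity
  have hy2 : 0 ≤ Φ * D * (2 / ε) * (2 * p) ^ (q + 1) := by positivity
  have hz : C ^ 2 * Φ * (4 * J + 2 * M) ≤ C ^ 2 * Φ * (4 + 2 * (p + 1)) * J := by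
    rw [mul_assoc (C ^ 2 * Φ)]
    gcongr
    linarith
  have h10 := mul_nonneg hy1 hx
  have h11 := mul_nonneg hy2 hJ0
  linarith

end Correlation

section InducedMeasure

variable {X : Type*} [MeasurableSpace X] {T : X → X} {Y : Set X} {φ : Y → ℕ} {F : Y → Y}
  {μ : Measure Y}

theorem measurableSet_tower (hφ : Measurable φ) : MeasurableSet (tower φ) :=
  measurableSet_lt measurable_snd (hφ.comp measurable_fst)

theorem preimage_tower {X : Type*} {Y : Set X} (φ : Y → ℕ) (y : Y) :
    Prod.mk y ⁻¹' tower φ = ↑(Finset.range (φ y)) := by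
  ext l
  simp [tower]

theorem toReal_lintegral_return (hφ : Measurable φ) :
    (∫⁻ y, (φ y : ℝ≥0∞) ∂μ).toReal = ∫ y, (φ y : ℝ) ∂μ := by
  have := integral_toReal (μ := μ) (f := fun y => (φ y : ℝ≥0∞))
    (measurable_from_nat.comp hφ).aemeasurable (ae_of_all _ fun y => ENNReal.natCast_lt_top _)
  simpa using this.symm

theorem lintegral_return_ne_top (hφi : Integrable (fun y => (φ y : ℝ)) μ) :
    ∫⁻ y, (φ y : ℝ≥0∞) ∂μ ≠ ∞ := by
  have := hφi.lintegral_lt_top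
  simpa using this.ne

theorem ae_forall_of_ae_inducedMeasure [SFinite μ] (hT : Measurable T) (hφ : Measurable φ)
    (hφi : Integrable (fun y => (φ y : ℝ)) μ) {p : X → Prop}
    (h : ∀ᵐ x ∂inducedMeasure T φ μ, p x) : ∀ᵐ y ∂μ, ∀ l < φ y, p (T^[l] (y : X)) := by
  have h1 := ae_of_ae_map (measurable_towerProj hT).aemeasurable h
  rw [towerMeasure, Measure.ae_ennreal_smul_measure_iff
    (ENNReal.inv_ne_zero.2 (lintegral_return_ne_top hφi)),
    ae_restrict_iff' (measurableSet_tower hφ)] at h1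
  filter_upwards [Measure.ae_ae_of_ae_prod h1] with y hy l hl
  rw [Measure.ae_count_iff] at hy
  exact hy l hl

theorem inducedMeasure_eq_zero [SFinite μ] (hT : Measurable T) (hφ : Measurable φ) {s : Set X}
    (hs : MeasurableSet s) (h : ∀ᵐ y ∂μ, ∀ l < φ y, T^[l] (y : X) ∉ s) :
    inducedMeasure T φ μ s = 0 := by
  have hπ := measurable_towerProj (Y := Y) hT
  rw [inducedMeasure, Measure.map_apply hπ hs, towerMeasure, Measure.smul_apply,
    Measure.restrict_apply (hπ hs), (Measure.measure_prod_null
      ((hπ hs).inter (measurableSet_tower hφ))).2, smul_zero]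
  filter_upwards [h] with y hy
  have : Prod.mk y ⁻¹' (towerProj T ⁻¹' s ∩ tower φ) = ∅ := by
    ext l
    simp only [mem_preimage, mem_inter_iff, mem_empty_iff_false, iff_false, not_and']
    exact fun hl => hy l hl
  rw [this, measure_empty]
  rfl

theorem quasiMeasurePreserving_inducedMeasure (hS : IsInducingScheme T Y φ F μ) :
    Measure.QuasiMeasurePreserving T (inducedMeasure T φ μ) (inducedMeasure T φ μ) := by
  have := hS.prob
  refine ⟨hS.measurable_map, Measure.AbsolutelyContinuous.mk fun s hs h0 => ?_⟩
  rw [Measure.map_apply hS.measurable_map hs]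
  refine inducedMeasure_eq_zero hS.measurable_map hS.measurable_return
    (hS.measurable_map hs) ?_
  have h1 := ae_forall_of_ae_inducedMeasure hS.measurable_map hS.measurable_return
    hS.integrable_return (measure_eq_zero_iff_ae_notMem.1 h0)
  filter_upwards [h1, hS.ergodic.quasiMeasurePreserving.ae h1] with y hy hFy l hl
  rw [mem_preimage, ← Function.iterate_succ_apply' T]
  rcases Nat.lt_or_ge (l + 1) (φ y) with h | h
  · exact hy _ h
  · rw [show l.succ = φ y by omega, ← hS.induced_eq]
    exact hFy 0 (hS.return_pos _)

theorem integral_inducedMeasure [IsProbabilityMeasure μ] (hT : Measurable T) (hφ : Measurable φ)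
    (hφi : Integrable (fun y => (φ y : ℝ)) μ) {g : X → ℝ} (hg : Measurable g) {C : ℝ}
    (hC : ∀ x, |g x| ≤ C) :
    ∫ x, g x ∂inducedMeasure T φ μ =
      (∫ y, (φ y : ℝ) ∂μ)⁻¹ * ∫ y, ∑ l ∈ Finset.range (φ y), g (T^[l] (y : X)) ∂μ := by
  have hπ := measurable_towerProj (Y := Y) hT
  have hm := measurableSet_tower hφ
  rw [inducedMeasure, integral_map hπ.aemeasurable hg.aestronglyMeasurable, towerMeasure,
    integral_smul_measure, ENNReal.toReal_inv, toReal_lintegral_return hφ, smul_eq_mul]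
  congr 1
  have hfin : (μ.prod Measure.count) (tower φ) ≠ ∞ := by
    rw [Measure.prod_apply hm]
    simp only [preimage_tower, Measure.count_apply_finset, Finset.card_range]
    exact lintegral_return_ne_top hφi
  have hint : IntegrableOn (fun q : Y × ℕ => g (towerProj T q)) (tower φ)
      (μ.prod Measure.count) :=
    Measure.integrableOn_of_bounded (M := C) hfin (hg.comp hπ).aestronglyMeasurable
      (ae_of_all _ fun q => hC _)
  rw [← integral_indicator hm, integral_prod _ ((integrable_indicator_iff hm).2 hint)]
  refine integral_congr_ae (ae_of_all _ fun y => ?_)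
  have h1 : (fun l => (tower φ).indicator (fun q : Y × ℕ => g (towerProj T q)) (y, l)) =
      (↑(Finset.range (φ y)) : Set ℕ).indicator fun l => g (T^[l] (y : X)) := by
    rw [← preimage_tower]
    rfl
  simp only
  rw [h1, integral_indicator (Finset.measurableSet _), setIntegral_finset]
  · simp [Measure.real]
  · exact Measure.integrableOn_of_bounded (M := C) (by simp)
      measurable_from_nat.aestronglyMeasurable (ae_of_all _ fun l => hC _)

theorem exists_bounded_measurable_ae_eq {ν : Measure X} {v : X → ℝ} (hv : MemLp v ∞ ν) :
    ∃ (v' : X → ℝ) (C : ℝ), Measurable v' ∧ (∀ x, |v' x| ≤ C) ∧ v =ᵐ[ν] v' := by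
  obtain ⟨u, hu, huv⟩ := hv.1
  set C := (eLpNorm v ∞ ν).toReal
  have hC : ∀ᵐ x ∂ν, |v x| ≤ C := by
    have h1 := ae_le_eLpNormEssSup (f := v) (μ := ν)
    filter_upwards [h1] with x hx
    rw [← eLpNorm_exponent_top] at hx
    have h2 := ENNReal.toReal_mono hv.2.ne hx
    rwa [toReal_enorm, Real.norm_eq_abs] at h2
  refine ⟨fun x => max (-C) (min C (u x)), C,
    measurable_const.max (measurable_const.min hu.measurable), fun x => ?_, ?_⟩
  · have hC0 : 0 ≤ C := ENNReal.toReal_nonneg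
    exact abs_le.2 ⟨le_max_left _ _, max_le (by linarith) (min_le_left _ _)⟩
  · filter_upwards [huv, hC] with x hx hx2
    rw [abs_le] at hx2
    rw [← hx, min_eq_right hx2.2, max_eq_right hx2.1]

variable {B : Type*} [NormedAddCommGroup B] [NormedSpace ℂ B] {ι : B →ₗ[ℂ] Lp ℂ 1 μ}

theorem Exchangeable.congr_ae (hS : IsInducingScheme T Y φ F μ) {v v' : X → ℝ}
    (hv : Exchangeable T φ ι v) (h : v =ᵐ[inducedMeasure T φ μ] v') : Exchangeable T φ ι v' := by
  have := hS.prob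
  obtain ⟨C, hC⟩ := hv
  refine ⟨C, fun u hu => ?_⟩
  choose! j hj hju using hu
  obtain ⟨b, hb, hbC⟩ := hC (fun y => v (T^[j (φ y)] (y : X))) fun n hn =>
    ⟨j n, hj n hn, fun y hy => by simp only [hy]⟩
  refine ⟨b, hb.trans ?_, hbC⟩
  filter_upwards [ae_forall_of_ae_inducedMeasure hS.measurable_map hS.measurable_return
    hS.integrable_return h] with y hy
  have h1 := hS.return_pos y
  rw [hy _ (hj _ h1), hju (φ y) h1 y rfl]

theorem correlation_congr_ae (hS : IsInducingScheme T Y φ F μ) {v v' w w' : X → ℝ}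
    (hv : v =ᵐ[inducedMeasure T φ μ] v') (hw : w =ᵐ[inducedMeasure T φ μ] w') (n : ℕ) :
    correlation T (inducedMeasure T φ μ) v w n = correlation T (inducedMeasure T φ μ) v' w' n := by
  have h1 := ((quasiMeasurePreserving_inducedMeasure hS).iterate n).ae_eq_comp hw
  rw [correlation, correlation, integral_congr_ae hv, integral_congr_ae hw]
  congr 1
  refine integral_congr_ae ?_
  filter_upwards [hv, h1] with x hx hx1
  have hx2 : w (T^[n] x) = w' (T^[n] x) := hx1
  rw [hx, hx2]

theorem one_le_integral_return (hS : IsInducingScheme T Y φ F μ) : 1 ≤ ∫ y, (φ y : ℝ) ∂μ := by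
  have := hS.prob
  have := integral_mono (μ := μ) (integrable_const (1 : ℝ)) hS.integrable_return fun y => by
    simpa using hS.return_pos y
  simpa using this

theorem correlation_eq (hS : IsInducingScheme T Y φ F μ) {v w : X → ℝ} (hv : Measurable v)
    (hw : Measurable w) {C : ℝ} (hvC : ∀ x, |v x| ≤ C) (hwC : ∀ x, |w x| ≤ C) (n : ℕ) :
    correlation T (inducedMeasure T φ μ) v w n = ((∫ y, (φ y : ℝ) ∂μ) ^ 2)⁻¹ *
      ((∫ y, ∑ l ∈ Finset.range (φ y), v (T^[l] (y : X)) * w (T^[n] (T^[l] (y : X))) ∂μ) *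
          (∫ y, (φ y : ℝ) ∂μ) -
        (∫ y, ∑ l ∈ Finset.range (φ y), w (T^[l] (y : X)) ∂μ) *
          ∫ y, ∑ l ∈ Finset.range (φ y), v (T^[l] (y : X)) ∂μ) := by
  have := hS.prob
  have h1 := one_le_integral_return hS
  have hT := hS.measurable_map
  have hi := fun (g : X → ℝ) (hg : Measurable g) (C : ℝ) (hC : ∀ x, |g x| ≤ C) =>
    integral_inducedMeasure hT hS.measurable_return hS.integrable_return hg hC
  rw [correlation, hi v hv C hvC, hi w hw C hwC,
    hi (fun x => v x * w (T^[n] x)) (hv.mul (hw.comp (hT.iterate n))) (C * C) fun x => ?_]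
  · have h2 : ∫ y, (φ y : ℝ) ∂μ ≠ 0 := by linarith
    field_simp
  · rw [abs_mul]
    exact mul_le_mul (hvC _) (hwC _) (abs_nonneg _) ((abs_nonneg _).trans (hvC x))

end InducedMeasure

end InducedDecay

end

theorem corollary1p6 {X : Type*} [MeasurableSpace X] (T : X → X) (Y : Set X)
    (φ : Y → ℕ) (F : Y → Y) (μ : Measure Y)
    (hF : InducedDecay.IsInducingScheme T Y φ F μ)
    {B : Type*} [NormedAddCommGroup B] [NormedSpace ℂ B]
    (ι : B →ₗ[ℂ] Lp ℂ 1 μ) (Rop : ℕ → B →L[ℂ] B)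
    (hgood : InducedDecay.IsGood F φ μ ι Rop)
    (ε : ℝ) (hε : 0 < ε)
    (hsum : ∑' n : ℕ, ENNReal.ofReal (((n + 1 : ℕ) : ℝ) ^ ε) *
      InducedDecay.normTail Rop (n + 1) < ∞)
    (q : ℝ) (hq : 0 < q)
    (hφ : MemLp (fun y => (φ y : ℝ)) (ENNReal.ofReal (q + 1)) μ)
    (v w : X → ℝ)
    (hv : MemLp v ∞ (InducedDecay.inducedMeasure T φ μ))
    (hex : InducedDecay.Exchangeable T φ ι v)
    (hw : MemLp w ∞ (InducedDecay.inducedMeasure T φ μ)) :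
    Summable (fun n : ℕ => ((n + 1 : ℕ) : ℝ) ^ (q - 1) *
      |InducedDecay.correlation T (InducedDecay.inducedMeasure T φ μ) v w (n + 1)|) := by
  have hprob := hF.prob
  obtain ⟨v', Cv, hv', hvC, hvv⟩ := InducedDecay.exists_bounded_measurable_ae_eq hv
  obtain ⟨w', Cw, hw', hwC, hww⟩ := InducedDecay.exists_bounded_measurable_ae_eq hw
  have hvC' : ∀ x, |v' x| ≤ max Cv Cw := fun x => (hvC x).trans (le_max_left _ _)
  have hwC' : ∀ x, |w' x| ≤ max Cv Cw := fun x => (hwC x).trans (le_max_right _ _)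
  obtain ⟨A, p, hA⟩ := InducedDecay.exists_correlation_bound hF hgood hε
    (InducedDecay.summable_of_tsum_normTail hε hsum) hq hv' hw' hvC' hwC' (hex.congr_ae hF hvv)
  have hφq : Integrable (fun y => (φ y : ℝ) ^ (q + 1)) μ := by
    have := hφ.integrable_norm_rpow (by simpa using by linarith) ENNReal.ofReal_ne_top
    rw [ENNReal.toReal_ofReal (by linarith)] at this
    simpa using this
  have hs1 := InducedDecay.summable_rpow_mul_tail hF.measurable_return hF.integrable_return hq
    hφq p
  have hs2 : Summable fun n : ℕ =>
      ((n + 1 : ℕ) : ℝ) ^ (q - 1) * ((n + 1 : ℕ) : ℝ) ^ (-(q + 1)) := by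
    have h1 := (summable_nat_add_iff 1).2 (Real.summable_nat_rpow.2 (by norm_num : (-2 : ℝ) < -1))
    refine h1.congr fun n => ?_
    rw [← Real.rpow_add (by positivity)]
    congr 1
    ring
  set Φ := ∫ y, (φ y : ℝ) ∂μ
  refine Summable.of_norm_bounded_eventually_nat ((hs1.add hs2).mul_left ((Φ ^ 2)⁻¹ * A)) ?_
  filter_upwards [(tendsto_add_atTop_nat 1).eventually hA] with n hn
  rw [InducedDecay.correlation_congr_ae hF hvv hww,
    InducedDecay.correlation_eq hF hv' hw' hvC' hwC', Real.norm_of_nonneg (by positivity),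
    abs_mul, abs_of_nonneg (by positivity)]
  refine (mul_le_mul_of_nonneg_left (mul_le_mul_of_nonneg_left hn (by positivity))
    (by positivity)).trans (le_of_eq ?_)
  ring
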